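/- Let $\mathbb T^1=\mathbb R/\mathbb Z$, let $h\in C^\infty(\mathbb T^1,\mathbb T^1)$ be such that $h(0)=0$, $h'(0)=0$, $h'(x)>0$ for every $x\neq 0$, $h'''(0)>0$ and $h(-x)=-h(x)$, and let $T:\mathbb T^2\to\mathbb T^2$ be the invertible map $$T(x,y)=(x+h(x)+y,\;h(x)+y)\pmod 1 .$$ For $\xi\in\mathbb T^2$ let $$E^u(\xi)=\Bigl\{v\in\mathbb R^2:\ \sup_{n\ge 0}\|D_\xi T^{-n}v\|<\infty\Bigr\},\qquad E^s(\xi)=\Bigl\{v\in\mathbb R^2:\ \sup_{n\ge 0}\|D_\xi T^{n}v\|<\infty\Bigr\}$$ be the unstable and the stable space at $\xi$. For a point $\xi=(x,y)$ of the torus write $|x|$, $|y|$ for the distances of $x$, $y$ to $0$ in $\mathbb R/\mathbb Z$. Proposition. There are constants $K_-,K_+>0$ (depending only on $h$) such that for every $\xi=(x,y)\in\mathbb T^2$ the spaces $E^u(\xi)$ and $E^s(\xi)$ are lines, spanned by vectors $(1,u)$ and $(1,-w)$ respectively, with $$K_-\bigl(|x|+\sqrt{|y|}\bigr)\le u\le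 K_+\bigl(|x|+\sqrt{|y|}\bigr),\qquad K_-\bigl(|x|+\sqrt{|y|}\bigr)\le w\le K_+\bigl(|x|+\sqrt{|y|}\bigr).$$ Moreover, if $\xi\neq 0$, then $D_\xi T^{-n}v\to 0$ for every $v\in E^u(\xi)$ and $D_\xi T^{n}v\to 0$ for every $v\in E^s(\xi)$, as $n\to\infty$. -/

import Mathlib

open Filter Topology
open scoped ContDiff

noncomputable section

/-- The two-dimensional torus `ℝ² / ℤ²`. -/
abbrev Torus : Type := UnitAddCircle × UnitAddCircle

/-- The covering projection `ℝ² → ℝ² / ℤ²`. -/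
def torusProj (v : ℝ × ℝ) : Torus := ((v.1 : UnitAddCircle), (v.2 : UnitAddCircle))

/-- The representative of a point of `ℝ / ℤ` in `[-1/2, 1/2)`. -/
def circleRep (θ : UnitAddCircle) : ℝ := (AddCircle.equivIco (1 : ℝ) (-1 / 2) θ : ℝ)

/-- The representative of a point of the torus in `[-1/2, 1/2)²`; near `0` it is the
inverse of the covering projection. -/
def torusRep (ξ : Torus) : ℝ × ℝ := (circleRep ξ.1, circleRep ξ.2)

/-- The derivative at `ξ` of a map of the torus, as a linear map of `ℝ²` (all tangent spaces
of the flat torus being identified with `ℝ²`). -/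
def torusDeriv (F : Torus → Torus) (ξ : Torus) : (ℝ × ℝ) →L[ℝ] (ℝ × ℝ) :=
  fderiv ℝ (fun v : ℝ × ℝ => torusRep (F (ξ + torusProj v) - F ξ)) 0

/-- The invertible map `T (x, y) = (x + h x + y, h x + y)` of the torus. -/
def intermittentMap (h : UnitAddCircle → UnitAddCircle) : Torus ≃ Torus where
  toFun ξ := (ξ.1 + h ξ.1 + ξ.2, h ξ.1 + ξ.2)
  invFun ξ := (ξ.1 - ξ.2, ξ.2 - h (ξ.1 - ξ.2))
  left_inv ξ := by
    have e : ξ.1 + h ξ.1 + ξ.2 - (h ξ.1 + ξ.2) = ξ.1 := by abel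
    ext
    · exact e
    · simp [e]
  right_inv ξ := by
    ext
    · change ξ.1 - ξ.2 + h (ξ.1 - ξ.2) + (ξ.2 - h (ξ.1 - ξ.2)) = ξ.1
      abel
    · change h (ξ.1 - ξ.2) + (ξ.2 - h (ξ.1 - ξ.2)) = ξ.2
      abel

/-- The vectors that stay bounded along a sequence of linear maps. -/
def boundedSpace (A : ℕ → (ℝ × ℝ) →L[ℝ] (ℝ × ℝ)) : Submodule ℝ (ℝ × ℝ) where
  carrier := {v | ∃ C : ℝ, ∀ n, ‖A n v‖ ≤ C}
  zero_mem' := ⟨0, fun n => by simp⟩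
  add_mem' := by
    rintro v w ⟨C, hC⟩ ⟨D, hD⟩
    refine ⟨C + D, fun n => ?_⟩
    rw [map_add]
    exact (norm_add_le _ _).trans (add_le_add (hC n) (hD n))
  smul_mem' := by
    rintro c v ⟨C, hC⟩
    refine ⟨‖c‖ * C, fun n => ?_⟩
    rw [map_smul, norm_smul]
    exact mul_le_mul_of_nonneg_left (hC n) (norm_nonneg c)

/-- The unstable space `E^u(ξ)` of a bijection `T` of the torus: the tangent vectors at `ξ`
whose images under `D T⁻ⁿ`, `n ≥ 0`, stay bounded. -/
def unstableSpace (T : Torus ≃ Torus) (ξ : Torus) : Submodule ℝ (ℝ × ℝ) :=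
  boundedSpace fun n => torusDeriv (T.symm)^[n] ξ

/-- The stable space `E^s(ξ)` of a bijection `T` of the torus: the tangent vectors at `ξ`
whose images under `D Tⁿ`, `n ≥ 0`, stay bounded. -/
def stableSpace (T : Torus ≃ Torus) (ξ : Torus) : Submodule ℝ (ℝ × ℝ) :=
  boundedSpace fun n => torusDeriv T^[n] ξ

/-- The size `|x| + √|y|` of a point `ξ = (x, y)` of the torus, where `|·|` is the distance
to `0` in `ℝ / ℤ` (which is the norm of `UnitAddCircle`). -/
def parabolicSize (ξ : Torus) : ℝ := ‖ξ.1‖ + Real.sqrt ‖ξ.2‖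

/-- The cone `{(1, u) | K₋ (|x| + √|y|) ≤ u ≤ K₊ (|x| + √|y|)}` at `ξ = (x, y)`. -/
def unstableCone (Km Kp : ℝ) (ξ : Torus) : Set (ℝ × ℝ) :=
  {v | ∃ u : ℝ, v = (1, u) ∧ Km * parabolicSize ξ ≤ u ∧ u ≤ Kp * parabolicSize ξ}

/-- The reflected cone `{(1, -w) | K₋ (|x| + √|y|) ≤ w ≤ K₊ (|x| + √|y|)}` at `ξ = (x, y)`. -/
def stableCone (Km Kp : ℝ) (ξ : Torus) : Set (ℝ × ℝ) :=
  {v | ∃ w : ℝ, v = (1, -w) ∧ Km * parabolicSize ξ ≤ w ∧ w ≤ Kp * parabolicSize ξ}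

end

/-!
The derivative of `T` at a point where `h' = a` sends the direction `(1, u)` to the direction
`(1, slopeMap (a + u))`, with `slopeMap s = s / (1 + s)`. An unstable direction therefore
corresponds to a sequence of slopes along the backward orbit that is invariant under these maps,
and the length of a vector on it is multiplied by `1 - u` at each backward step.

*Existence and bounds* (`CubicTangency.exists_unstable_slopes`). Write
`q = √(|x| ^ 2 + |y|)`, which is comparable to `|x| + √|y|` and changes by `O(q ^ 2)` in one step,
since `h = O(|x| ^ 3)`. As `h' = O(q ^ 2)`, the slopes below `K q` are mapped below `K q` if `K` is
large, so transporting the slopes `K q` from ever earlier times yields a decreasing sequence, whose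
limit is invariant. For the lower bound one needs a function comparable to `q` that, times a small
constant, is a lower barrier; `q` itself is not, because there is no expansion on the axis `x = 0`.
Near the origin `T` is close to the flow `x' = y`, `y' = h x`, and along it
`(x y / q ^ 2)' = y ^ 2 / q ^ 2 + O(x ^ 2)`; hence `L = q - x y / (2 q ^ 2)` decreases by an amount
of order `q ^ 2` when the orbit crosses the axis, and any increase is controlled by
`x ^ 2 = O(h')` (`lyapunov_step`). Away from the origin it suffices that an orbit is not near the
axis at two consecutive times (`CubicTangency.exists_le_circleDeriv_add`).

*Uniqueness* (`IsBackwardTransport.bounded_iff`). `D T⁻¹` preserves the second and fourth quadrants,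
and vertical vectors grow at least linearly in the past; so the bounded vectors are exactly those
on the invariant line.

*Contraction* (`IsBackwardTransport.tendsto_zero`). Since `q` changes by `O(q ^ 2)`, it is at least
of order `1 / n` after `n` steps unless it vanishes. By the lower bound the sum of the slopes
diverges, so the product of the factors `1 - u` tends to `0`.

*Stable spaces* (`stableSpace_of_slopes`). The reversor `(x, y) ↦ (x, - y - h x)` conjugates `T` to
`T⁻¹` and changes `q` at most by a bounded factor. It carries the unstable line of slope `u` at the
reversed point to the stable line of slope `-(h' x + u)`.
-/

/-! ### The action of the derivative on slopes -/

/-- The map `s ↦ s / (1 + s)`. The derivative of `T` at a point where `h' = a` sends the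
direction `(1, u)` to the direction `(1, slopeMap (a + u))`. -/
noncomputable def slopeMap (s : ℝ) : ℝ := s / (1 + s)

lemma slopeMap_nonneg {s : ℝ} (hs : 0 ≤ s) : 0 ≤ slopeMap s := by
  unfold slopeMap; positivity

lemma slopeMap_mono {s t : ℝ} (hs : 0 ≤ s) (hst : s ≤ t) : slopeMap s ≤ slopeMap t := by
  unfold slopeMap
  rw [div_le_div_iff₀ (by linarith) (by linarith)]
  nlinarith

lemma slopeMap_lt_one {s : ℝ} (hs : 0 ≤ s) : slopeMap s < 1 := by
  unfold slopeMap
  rw [div_lt_one (by linarith)]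
  linarith

lemma slopeMap_le_self {s : ℝ} (hs : 0 ≤ s) : slopeMap s ≤ s := by
  unfold slopeMap
  rw [div_le_iff₀ (by linarith)]
  nlinarith

lemma le_slopeMap_iff {s z : ℝ} (hs : 0 ≤ s) : z ≤ slopeMap s ↔ z * (1 + s) ≤ s := by
  unfold slopeMap
  rw [le_div_iff₀ (by linarith)]

lemma slopeMap_le_iff {s z : ℝ} (hs : 0 ≤ s) : slopeMap s ≤ z ↔ s ≤ z * (1 + s) := by
  unfold slopeMap
  rw [div_le_iff₀ (by linarith)]

lemma slopeMap_add_le {s t : ℝ} (hs : 0 ≤ s) (ht : 0 ≤ t) :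
    slopeMap (s + t) ≤ slopeMap s + slopeMap t := by
  unfold slopeMap
  rw [add_div]
  gcongr <;> linarith

lemma continuousAt_slopeMap {s : ℝ} (hs : 0 ≤ s) : ContinuousAt slopeMap s := by
  unfold slopeMap
  exact continuousAt_id.div (by fun_prop) (by positivity)

/-- The slope at time `n` obtained by transporting the slope `up (n + N)` through `N` steps;
`a` is the sequence of values of `h'` along a backward orbit, so time runs towards `0`. -/
noncomputable def pulledSlope (a up : ℕ → ℝ) : ℕ → ℕ → ℝ
  | 0, n => up n
  | N + 1, n => slopeMap (a (n + 1) + pulledSlope a up N (n + 1))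

/-- A sequence of slopes that is mapped below itself, and whose transports stay above `lo`, lies
above an invariant sequence of slopes: the decreasing limit of its transports. -/
theorem exists_invariant_slopes {a up lo : ℕ → ℝ} (ha : ∀ n, 0 ≤ a n) (hup0 : ∀ n, 0 ≤ up n)
    (hup : ∀ n, slopeMap (a (n + 1) + up (n + 1)) ≤ up n)
    (hlo : ∀ N n, lo n ≤ pulledSlope a up N n) :
    ∃ u : ℕ → ℝ, ∀ n, 0 ≤ u n ∧ lo n ≤ u n ∧ u n ≤ up n ∧
      u n = slopeMap (a (n + 1) + u (n + 1)) := by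
  have h0 : ∀ N n, 0 ≤ pulledSlope a up N n := by
    intro N
    induction N with
    | zero => exact hup0
    | succ N ih => exact fun n => slopeMap_nonneg (add_nonneg (ha _) (ih _))
  have hstep : ∀ N n, pulledSlope a up (N + 1) n ≤ pulledSlope a up N n := by
    intro N
    induction N with
    | zero => exact hup
    | succ N ih =>
      intro n
      exact slopeMap_mono (add_nonneg (ha _) (h0 _ _)) (by linarith [ih (n + 1)])
  have hanti : ∀ n, Antitone fun N => pulledSlope a up N n := fun n =>
    antitone_nat_of_succ_le fun N => hstep N n
  have hlim : ∀ n, ∃ l, Tendsto (fun N => pulledSlope a up N n) atTop (𝓝 l) := fun n =>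
    ⟨_, tendsto_atTop_ciInf (hanti n) ⟨0, by rintro _ ⟨N, rfl⟩; exact h0 N n⟩⟩
  choose u hu using hlim
  have hu0 : ∀ n, 0 ≤ u n := fun n => ge_of_tendsto' (hu n) fun N => h0 N n
  refine ⟨u, fun n => ⟨hu0 n, ge_of_tendsto' (hu n) fun N => hlo N n,
    le_of_tendsto' (hu n) fun N => hanti n (Nat.zero_le N), ?_⟩⟩
  refine tendsto_nhds_unique ((tendsto_add_atTop_iff_nat 1).2 (hu n)) ?_
  exact (continuousAt_slopeMap (add_nonneg (ha _) (hu0 _))).tendsto.comp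
    ((hu (n + 1)).const_add (a (n + 1)))

/-! ### Vectors transported along a backward orbit -/

/-- The coordinates of a tangent vector transported along a backward orbit of `T`, on which `h'`
takes the values `a`. -/
def IsBackwardTransport (a p r : ℕ → ℝ) : Prop :=
  ∀ n, p (n + 1) = p n - r n ∧ r (n + 1) = r n - a (n + 1) * p (n + 1)

/-- A vector on an invariant sequence of lines stays on it, and is contracted by `1 - u n`. -/
lemma IsBackwardTransport.on_line {a u p r : ℕ → ℝ} (ha : ∀ n, 0 ≤ a n) (hu0 : ∀ n, 0 ≤ u n)
    (hu : ∀ n, u n = slopeMap (a (n + 1) + u (n + 1))) (h : IsBackwardTransport a p r)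
    (h0 : r 0 = u 0 * p 0) (n : ℕ) : r n = u n * p n ∧ p (n + 1) = (1 - u n) * p n := by
  have key : ∀ n, r n = u n * p n := by
    intro n
    induction n with
    | zero => exact h0
    | succ n ih =>
      obtain ⟨h1, h2⟩ := h n
      have hpos : 0 < 1 + (a (n + 1) + u (n + 1)) := by linarith [ha (n + 1), hu0 (n + 1)]
      have e := hu n
      rw [slopeMap, eq_div_iff hpos.ne'] at e
      rw [h2, h1, ih]
      linear_combination p n * e
  exact ⟨key n, by rw [(h n).1, key n]; ring⟩

/-- Backward transport of a vertical vector grows at least linearly, since `D T⁻¹` preserves the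
second and fourth quadrants. -/
lemma IsBackwardTransport.unbounded_of_vertical {a p r : ℕ → ℝ} (ha : ∀ n, 0 ≤ a n)
    (h : IsBackwardTransport a p r) (hp : p 0 = 0) (n : ℕ) :
    n * |r 0| ≤ |p n| := by
  have key : ∀ n, ∃ P R : ℝ, p n = -(P * r 0) ∧ r n = R * r 0 ∧ (n : ℝ) ≤ P ∧ 1 ≤ R := by
    intro n
    induction n with
    | zero => exact ⟨0, 1, by simp [hp], by simp, by simp, le_rfl⟩
    | succ n ih =>
      obtain ⟨P, R, e1, e2, hP, hR⟩ := ih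
      obtain ⟨h1, h2⟩ := h n
      have hn : (0 : ℝ) ≤ n := n.cast_nonneg
      refine ⟨P + R, R + a (n + 1) * (P + R), by rw [h1, e1, e2]; ring,
        by rw [h2, h1, e1, e2]; ring, by push_cast; linarith, ?_⟩
      have := mul_nonneg (ha (n + 1)) (by linarith : 0 ≤ P + R)
      linarith
  obtain ⟨P, R, e, -, hP, -⟩ := key n
  have hn : (0 : ℝ) ≤ n := n.cast_nonneg
  rw [e, abs_neg, abs_mul, abs_of_nonneg (hn.trans hP)]
  gcongr

/-- The coefficients by which the invariant line is contracted. -/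
noncomputable def lineFactor (u : ℕ → ℝ) (n : ℕ) : ℝ := ∏ j ∈ Finset.range n, (1 - u j)

lemma lineFactor_succ (u : ℕ → ℝ) (n : ℕ) : lineFactor u (n + 1) = lineFactor u n * (1 - u n) :=
  Finset.prod_range_succ _ _

lemma lineFactor_mem {u : ℕ → ℝ} (hu0 : ∀ n, 0 ≤ u n) (hu1 : ∀ n, u n ≤ 1) (n : ℕ) :
    0 ≤ lineFactor u n ∧ lineFactor u n ≤ 1 :=
  ⟨Finset.prod_nonneg fun j _ => by linarith [hu1 j],
    Finset.prod_le_one (fun j _ => by linarith [hu1 j]) fun j _ => by linarith [hu0 j]⟩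

lemma IsBackwardTransport.eq_lineFactor {a u p r : ℕ → ℝ} (ha : ∀ n, 0 ≤ a n)
    (hu0 : ∀ n, 0 ≤ u n)
    (hu : ∀ n, u n = slopeMap (a (n + 1) + u (n + 1))) (h : IsBackwardTransport a p r)
    (h0 : r 0 = u 0 * p 0) (n : ℕ) :
    p n = lineFactor u n * p 0 ∧ r n = u n * (lineFactor u n * p 0) := by
  have key : p n = lineFactor u n * p 0 := by
    induction n with
    | zero => simp [lineFactor]
    | succ n ih => rw [(h.on_line ha hu0 hu h0 n).2, ih, lineFactor_succ]; ring
  exact ⟨key, by rw [(h.on_line ha hu0 hu h0 n).1, key]⟩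

/-- The bounded backward transports are those of the vectors on the invariant line. -/
theorem IsBackwardTransport.bounded_iff {a u p r : ℕ → ℝ} (ha : ∀ n, 0 ≤ a n)
    (hu0 : ∀ n, 0 ≤ u n)
    (hu : ∀ n, u n = slopeMap (a (n + 1) + u (n + 1))) (h : IsBackwardTransport a p r) :
    (∃ C, ∀ n, |p n| ≤ C ∧ |r n| ≤ C) ↔ r 0 = u 0 * p 0 := by
  have hu1 : ∀ n, u n ≤ 1 := fun n => by
    rw [hu n]; exact (slopeMap_lt_one (add_nonneg (ha _) (hu0 _))).le
  have hc := lineFactor_mem hu0 hu1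
  constructor
  · rintro ⟨C, hC⟩
    -- subtracting the transport of a vector on the line leaves that of a vertical vector
    let q : ℕ → ℝ := fun n => lineFactor u n * p 0
    have hq : IsBackwardTransport a q (fun n => u n * q n) := by
      intro n
      have hpos : 0 < 1 + (a (n + 1) + u (n + 1)) := by linarith [ha (n + 1), hu0 (n + 1)]
      have e := hu n
      rw [slopeMap, eq_div_iff hpos.ne'] at e
      simp only [q, lineFactor_succ]
      refine ⟨by ring, ?_⟩
      linear_combination (-lineFactor u n * p 0) * e
    have hd : IsBackwardTransport a (fun n => p n - q n) (fun n => r n - u n * q n) := by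
      intro n
      refine ⟨by linear_combination (h n).1 - (hq n).1, by linear_combination (h n).2 - (hq n).2⟩
    have hgrow := hd.unbounded_of_vertical ha (by simp [q, lineFactor])
    by_contra hne
    have hne' : 0 < |r 0 - u 0 * q 0| := by
      rw [abs_pos, sub_ne_zero]
      simpa [q, lineFactor] using hne
    obtain ⟨n, hn⟩ := exists_nat_gt ((C + |p 0|) / |r 0 - u 0 * q 0|)
    rw [div_lt_iff₀ hne'] at hn
    have h1 : |q n| ≤ |p 0| := by
      simp only [q, abs_mul, abs_of_nonneg (hc n).1]
      exact mul_le_of_le_one_left (abs_nonneg _) (hc n).2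
    have h2 := hgrow n
    have h3 := abs_sub (p n) (q n)
    linarith [(hC n).1]
  · intro h0
    refine ⟨|p 0|, fun n => ?_⟩
    obtain ⟨e1, e2⟩ := h.eq_lineFactor ha hu0 hu h0 n
    have h1 : |p n| ≤ |p 0| := by
      rw [e1, abs_mul, abs_of_nonneg (hc n).1]
      exact mul_le_of_le_one_left (abs_nonneg _) (hc n).2
    refine ⟨h1, ?_⟩
    rw [e2, ← e1, abs_mul, abs_of_nonneg (hu0 n)]
    exact (mul_le_of_le_one_left (abs_nonneg _) (hu1 n)).trans h1

lemma lineFactor_tendsto_zero {u : ℕ → ℝ} (hu0 : ∀ n, 0 ≤ u n) (hu1 : ∀ n, u n ≤ 1)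
    (hsum : ¬ Summable u) : Tendsto (lineFactor u) atTop (𝓝 0) := by
  have hc := lineFactor_mem hu0 hu1
  have hanti : Antitone (lineFactor u) := antitone_nat_of_succ_le fun n => by
    rw [lineFactor_succ]
    exact mul_le_of_le_one_right (hc n).1 (by linarith [hu0 n])
  have hlim := tendsto_atTop_ciInf hanti ⟨0, by rintro _ ⟨n, rfl⟩; exact (hc n).1⟩
  set l := ⨅ n, lineFactor u n
  have hl : ∀ n, l ≤ lineFactor u n := fun n => hanti.le_of_tendsto hlim n
  have hl0 : 0 ≤ l := ge_of_tendsto' hlim fun n => (hc n).1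
  rcases hl0.eq_or_lt with h | h
  · rwa [← h] at hlim
  · -- a positive limit bounds `∑ u`, because the factors telescope
    refine absurd (summable_of_sum_range_le (c := 1 / l) hu0 fun n => ?_) hsum
    rw [le_div_iff₀ h, Finset.sum_mul]
    have : ∀ n, ∑ j ∈ Finset.range n, u j * l ≤ 1 - lineFactor u n := by
      intro n
      induction n with
      | zero => simp [lineFactor]
      | succ n ih =>
        rw [Finset.sum_range_succ, lineFactor_succ]
        nlinarith [mul_le_mul_of_nonneg_left (hl n) (hu0 n)]
    linarith [this n, (hc n).1]

/-- If the sizes `Q n` decrease at most like the solutions of `Q' = - C Q ^ 2`, and bound the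
invariant slopes from below, then vectors on the invariant line tend to `0`. -/
theorem IsBackwardTransport.tendsto_zero {a u p r Q : ℕ → ℝ} {k C : ℝ} (ha : ∀ n, 0 ≤ a n)
    (hu0 : ∀ n, 0 ≤ u n)
    (hu : ∀ n, u n = slopeMap (a (n + 1) + u (n + 1))) (h : IsBackwardTransport a p r)
    (h0 : r 0 = u 0 * p 0) (hk : 0 < k) (hC : 0 ≤ C) (hQ : ∀ n, 0 ≤ Q n) (hQ0 : 0 < Q 0)
    (hQstep : ∀ n, Q n ≤ Q (n + 1) * (1 + C * Q (n + 1))) (hkQ : ∀ n, k * Q n ≤ u n) :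
    Tendsto p atTop (𝓝 0) ∧ Tendsto r atTop (𝓝 0) := by
  have hu1 : ∀ n, u n ≤ 1 := fun n => by
    rw [hu n]; exact (slopeMap_lt_one (add_nonneg (ha _) (hu0 _))).le
  have hQpos : ∀ n, 0 < Q n := by
    intro n
    induction n with
    | zero => exact hQ0
    | succ n ih =>
      refine (hQ _).lt_of_ne fun e => ?_
      have := hQstep n
      rw [← e] at this
      linarith
  have hinv : ∀ n : ℕ, 1 / Q n ≤ 1 / Q 0 + C * n := by
    intro n
    induction n with
    | zero => simp
    | succ n ih =>
      have h1 := hQpos n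
      have h2 := hQpos (n + 1)
      have : 1 / Q (n + 1) ≤ 1 / Q n + C := by
        rw [div_add' _ _ _ h1.ne', div_le_div_iff₀ h2 h1]
        have h3 : 0 ≤ C * Q (n + 1) := by positivity
        have h4 := hQstep n
        by_cases h5 : Q n ≤ Q (n + 1)
        · nlinarith [mul_nonneg h3 h1.le]
        · push Not at h5
          nlinarith [mul_le_mul_of_nonneg_left h5.le h3]
      push_cast
      linarith
  have hsum : ¬ Summable u := by
    intro hs
    set A : ℝ := 1 / Q 0 + C + 1
    have hA : 0 < A := by positivity
    have : Summable fun n : ℕ => 1 / ((n : ℝ) + 1) := by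
      refine Summable.of_nonneg_of_le (fun n => by positivity) (fun n => ?_)
        (hs.mul_left (A / k))
      have h1 := hQpos n
      have h2 := hinv n
      have h3 : 1 / Q n ≤ A * (n + 1) := by
        have : (0 : ℝ) ≤ 1 / Q 0 * n := by positivity
        have : (0 : ℝ) ≤ n := n.cast_nonneg
        simp only [A]
        nlinarith
      rw [div_le_iff₀ h1] at h3
      have h4 : Q n ≤ u n / k := by rw [le_div_iff₀ hk]; linarith [hkQ n]
      rw [div_le_iff₀ (by positivity)]
      calc (1 : ℝ) ≤ A * (n + 1) * Q n := h3
        _ ≤ A * (n + 1) * (u n / k) := by gcongr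
        _ = A / k * u n * (n + 1) := by ring
    refine Real.not_summable_one_div_natCast ((summable_nat_add_iff 1).1 ?_)
    simpa using this
  have hc := lineFactor_tendsto_zero hu0 hu1 hsum
  have hp : Tendsto p atTop (𝓝 0) := by
    have := hc.mul_const (p 0)
    rw [zero_mul] at this
    exact this.congr fun n => ((h.eq_lineFactor ha hu0 hu h0 n).1).symm
  refine ⟨hp, squeeze_zero_norm (fun n => ?_) (tendsto_zero_iff_norm_tendsto_zero.1 hp)⟩
  rw [(h.on_line ha hu0 hu h0 n).1, norm_mul, Real.norm_of_nonneg (hu0 n)]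
  exact mul_le_of_le_one_left (norm_nonneg _) (hu1 n)

/-! ### The cone estimates for one step of the map -/

/-- Changing the square of a size by a cubic term changes the size by a quadratic term. -/
lemma le_mul_of_sq_le_cube {q q' C : ℝ} (hq' : 0 ≤ q') (hC : 0 ≤ C)
    (h : q ^ 2 ≤ q' ^ 2 + C * q' ^ 3) : q ≤ q' * (1 + C * q') := by
  refine le_of_sq_le_sq ?_ (by positivity)
  have : 0 ≤ C * q' ^ 3 + C ^ 2 * q' ^ 4 := by positivity
  nlinarith

/-- A step of the map `y' = y + k`, `x' = x + y'` with `k` of order `x ^ 3`, close to the origin.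
The function `q - x y / (2 q ^ 2)`, comparable to `q`, decreases by an amount of order `q ^ 2`,
up to a multiple of `x ^ 2`: the term `x y` makes it decrease while an orbit crosses the axis
`x = 0`, where `h'` does not expand. -/
theorem lyapunov_step {C : ℝ} (hC : 0 ≤ C) {x y k x' y' q q' : ℝ} (hk : |k| ≤ C * |x| ^ 3)
    (hy' : y' = y + k) (hx' : x' = x + y') (hq0 : 0 ≤ q) (hq0' : 0 ≤ q')
    (hq : q ^ 2 = x ^ 2 + |y|) (hq' : q' ^ 2 = x' ^ 2 + |y'|) (hsmall : 100 * (1 + C) * q' ≤ 1) :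
    q' - x' * y' / (2 * q' ^ 2) ≤
      q - x * y / (2 * q ^ 2) + (24 + 4 * C) * x ^ 2 - q' ^ 2 / 8 := by
  have hCq : 0 ≤ C * q' := by positivity
  have hq1 : 100 * q' ≤ 1 := by linarith
  have hX : |x'| ≤ q' := abs_le_of_sq_le_sq (by linarith [abs_nonneg y']) hq0'
  have hY : |y'| ≤ q' ^ 2 := by linarith [sq_nonneg x']
  have hx : |x| ≤ |x'| + |y'| := by
    have : x = x' - y' := by linarith
    rw [this]; exact abs_sub _ _
  have hx2 : |x| ≤ 2 * q' := by
    have : q' * (100 * q') ≤ q' * 1 := by gcongr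
    linarith
  have hxq : |x| ≤ q := abs_le_of_sq_le_sq (by linarith [abs_nonneg y]) hq0
  have hsx : |x| ^ 2 = x ^ 2 := sq_abs x
  have hsy : |y'| ^ 2 = y' ^ 2 := sq_abs y'
  have hax := abs_nonneg x
  have hay := abs_nonneg y'
  have hk3 : |x| ^ 3 = |x| * x ^ 2 := by rw [← hsx]; ring
  set D := 2 * |x| * |y'| + y' ^ 2 + C * |x| ^ 3 with hD
  have hDiff : |q' ^ 2 - q ^ 2| ≤ D := by
    have e : q' ^ 2 - q ^ 2 = 2 * (x * y') + y' ^ 2 + (|y'| - |y|) := by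
      rw [hq, hq', hx']; ring
    have h1 : |(|y'| - |y|)| ≤ |k| := by
      refine (abs_abs_sub_abs_le_abs_sub _ _).trans ?_
      rw [hy', add_sub_cancel_left]
    rw [e]
    refine (abs_add_three _ _ _).trans ?_
    rw [abs_mul, abs_mul, abs_two, abs_of_nonneg (sq_nonneg y')]
    simp only [hD]
    linarith
  have hDq : D ≤ q' ^ 2 / 2 := by
    have h1 : |x| * |y'| ≤ 2 * q' * q' ^ 2 := by gcongr
    have h2 : y' ^ 2 ≤ q' ^ 2 * q' ^ 2 := by rw [← hsy, sq]; gcongr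
    have h3 : C * |x| ^ 3 ≤ C * (2 * q') ^ 3 := by gcongr
    have h4 : q' ^ 2 * (100 * (1 + C) * q') ≤ q' ^ 2 * 1 := by gcongr
    have h5 : q' ^ 2 * (100 * q') ≤ q' ^ 2 * 1 := by gcongr
    have h6 : q' ^ 3 * (100 * q') ≤ q' ^ 3 * 1 := by gcongr
    have h7 : 0 ≤ q' ^ 3 := by positivity
    simp only [hD]
    linarith
  have hle := abs_le.1 hDiff
  rcases hq0'.eq_or_lt with h0 | hpos'
  · have h0' : q' ^ 2 = 0 := by rw [← h0]; norm_num
    have h1 : q ^ 2 = 0 := le_antisymm (by linarith) (sq_nonneg q)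
    have h2 : q = 0 := by simpa using h1
    have h3 : 0 ≤ (24 + 4 * C) * x ^ 2 := by positivity
    rw [← h0, h2]; simpa using h3
  have hpos : 0 < q := by
    refine hq0.lt_of_ne fun e => ?_
    have h1 : q ^ 2 = 0 := by rw [← e]; norm_num
    linarith [pow_pos hpos' 2]
  -- the increment of the size
  have hI : q' - q ≤ q' ^ 2 / 16 + 16 * x ^ 2 + q' ^ 3 + 2 * C * x ^ 2 := by
    have h1 : (q' - q) * q' ≤ D := by
      rcases le_total q q' with h | h
      · have := mul_nonneg (sub_nonneg.2 h) hq0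
        linarith
      · have h5 : 0 ≤ D := by positivity
        exact (mul_nonpos_of_nonpos_of_nonneg (sub_nonpos.2 h) hq0').trans h5
    have h2 : D ≤ (2 * |x| * q' + q' ^ 3 + 2 * C * x ^ 2) * q' := by
      have e1 : |x| * |y'| ≤ |x| * q' ^ 2 := by gcongr
      have e2 : y' ^ 2 ≤ q' ^ 2 * q' ^ 2 := by rw [← hsy, sq]; gcongr
      have e3 : C * |x| ^ 3 ≤ C * (2 * q' * x ^ 2) := by rw [hk3]; gcongr
      simp only [hD]
      linarith
    have h3 := le_of_mul_le_mul_right (h1.trans h2) hpos'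
    have h4 : 2 * |x| * q' ≤ q' ^ 2 / 16 + 16 * x ^ 2 := by
      rw [← hsx]
      linarith [sq_nonneg (q' / 4 - 4 * |x|)]
    linarith
  -- the increment of `x y / q ^ 2`
  have hW : 2 / 3 * q' ^ 2 - (16 + 3 * C) * (x ^ 2 + q' ^ 4) ≤
      x' * y' / q' ^ 2 - x * y / q ^ 2 := by
    have hqq : q ^ 2 ≤ 3 / 2 * q' ^ 2 := by linarith
    have hqq' : q' ^ 2 ≤ 2 * q ^ 2 := by linarith
    have hsq : 0 < q ^ 2 := by positivity
    have hW' : |x' * y' / q' ^ 2| ≤ |x'| := by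
      rw [abs_div, abs_mul, abs_of_pos (pow_pos hpos' 2), div_le_iff₀ (by positivity)]
      gcongr
    have e : (x' * y' / q' ^ 2 - x * y / q ^ 2) * q ^ 2 =
        x * k + y' ^ 2 - x' * y' / q' ^ 2 * (q' ^ 2 - q ^ 2) := by
      have : x' * y' = x * y + x * k + y' ^ 2 := by rw [hx', hy']; ring
      field_simp
      linear_combination q' ^ 2 * this
    refine le_of_mul_le_mul_right ?_ hsq
    rw [e]
    have h1 : -(C * x ^ 2 * q ^ 2) ≤ x * k := by
      have : |x * k| ≤ C * x ^ 2 * q ^ 2 := by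
        rw [abs_mul]
        calc |x| * |k| ≤ |x| * (C * |x| ^ 3) := by gcongr
          _ = C * |x| ^ 2 * |x| ^ 2 := by ring
          _ ≤ C * |x| ^ 2 * q ^ 2 := by gcongr
          _ = _ := by rw [hsx]
      exact (abs_le.1 this).1
    have h2 : x' * y' / q' ^ 2 * (q' ^ 2 - q ^ 2) ≤ q ^ 2 * (2 * (4 + C) * (x ^ 2 + y' ^ 2)) := by
      have hDb : D ≤ q ^ 2 * ((4 + C) * (|x| + |y'|)) := by
        have hY2 : |y'| ≤ 2 * q ^ 2 := hY.trans hqq'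
        have e1 : |x| * |y'| ≤ |x| * (2 * q ^ 2) := by gcongr
        have e2 : y' ^ 2 ≤ |y'| * (2 * q ^ 2) := by rw [← hsy, sq]; gcongr
        have e3 : C * |x| ^ 3 ≤ C * (|x| * q ^ 2) := by
          rw [pow_succ']; gcongr
        have e4 : 0 ≤ C * |y'| * q ^ 2 := by positivity
        have e5 : 0 ≤ |y'| * q ^ 2 := by positivity
        simp only [hD]
        linarith
      calc x' * y' / q' ^ 2 * (q' ^ 2 - q ^ 2) ≤ |x' * y' / q' ^ 2| * |q' ^ 2 - q ^ 2| := by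
            rw [← abs_mul]; exact le_abs_self _
        _ ≤ (|x| + |y'|) * (q ^ 2 * ((4 + C) * (|x| + |y'|))) := by
            refine mul_le_mul (hW'.trans ?_) (hDiff.trans hDb) (abs_nonneg _) (by positivity)
            rw [hx']; exact abs_add_le _ _
        _ = q ^ 2 * (4 + C) * (|x| + |y'|) ^ 2 := by ring
        _ ≤ q ^ 2 * (4 + C) * (2 * (x ^ 2 + y' ^ 2)) := by
            gcongr
            rw [← hsx, ← hsy]
            linarith [sq_nonneg (|x| - |y'|)]
        _ = _ := by ring
    have h3 : q' ^ 2 * q' ^ 2 - 2 * q' ^ 2 * x' ^ 2 ≤ y' ^ 2 := by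
      have : |y'| = q' ^ 2 - x' ^ 2 := by linarith
      rw [← hsy, this]; linarith [sq_nonneg (x' ^ 2)]
    have h4 : x' ^ 2 ≤ 2 * x ^ 2 + 2 * y' ^ 2 := by
      rw [hx']; linarith [sq_nonneg (x - y')]
    have h5 : q' ^ 2 * x' ^ 2 ≤ 2 * q ^ 2 * (2 * x ^ 2 + 2 * y' ^ 2) := by gcongr
    have h6 : y' ^ 2 ≤ q' ^ 4 := by
      rw [← hsy, show q' ^ 4 = (q' ^ 2) ^ 2 by ring]; gcongr
    have h7 : q ^ 2 * q' ^ 2 ≤ 3 / 2 * q' ^ 2 * q' ^ 2 := by gcongr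
    have h8 : q ^ 2 * y' ^ 2 ≤ q ^ 2 * q' ^ 4 := by gcongr
    have h9 : C * (q ^ 2 * y' ^ 2) ≤ C * (q ^ 2 * q' ^ 4) := by gcongr
    have h10 : 0 ≤ C * (q ^ 2 * x ^ 2) := by positivity
    have h11 : q ^ 2 * q' ^ 2 ≤ 3 / 2 * q' ^ 4 := by linarith only [h7]
    have h12 : 0 ≤ C * (q ^ 2 * q' ^ 4) := by positivity
    linarith only [h1, h2, h3, h5, h8, h9, h10, h11, h12]
  have hfin : (9 + 3 / 2 * C) * q' ^ 3 ≤ q' ^ 2 / 8 := by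
    have h1 : (9 + 3 / 2 * C) * q' ≤ 1 / 8 := by linarith
    have h2 : q' ^ 2 * ((9 + 3 / 2 * C) * q') ≤ q' ^ 2 * (1 / 8) := by gcongr
    linarith
  have h43 : q' ^ 4 ≤ q' ^ 3 := by
    have h6 : q' ^ 3 * (100 * q') ≤ q' ^ 3 * 1 := by gcongr
    have h7 : 0 ≤ q' ^ 3 := by positivity
    linarith
  have h43C : C * q' ^ 4 ≤ C * q' ^ 3 := by gcongr
  have r1 : x' * y' / (2 * q' ^ 2) = x' * y' / q' ^ 2 / 2 := by rw [mul_comm 2, div_div]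
  have r2 : x * y / (2 * q ^ 2) = x * y / q ^ 2 / 2 := by rw [mul_comm 2, div_div]
  rw [r1, r2]
  have h2q : 0 ≤ q' ^ 2 := by positivity
  have hCx : 0 ≤ C * x ^ 2 := by positivity
  linarith [sq_nonneg x]

/-- The cone of slopes above `k L` is mapped into itself where `L` has the decrease of
`lyapunov_step`. -/
lemma lower_cone_step {a u k c M L L' q' x : ℝ} (ha : 0 ≤ a) (hu : 0 ≤ u) (hax : c * x ^ 2 ≤ a)
    (huL : k * L ≤ u) (hk0 : 0 ≤ k) (hk : 64 * k ≤ 1) (hkM : k * M ≤ c) (hL'0 : 0 ≤ L')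
    (hL' : L' ≤ 2 * q') (hkL' : 2 * (k * L') ≤ 1) (hstep : L' ≤ L + M * x ^ 2 - q' ^ 2 / 8) :
    k * L' ≤ slopeMap (a + u) := by
  rw [le_slopeMap_iff (add_nonneg ha hu)]
  have h1 : k * L' ≤ k * (L + M * x ^ 2 - q' ^ 2 / 8) := by gcongr
  have h2 : k * M * x ^ 2 ≤ c * x ^ 2 := by gcongr
  have h3 : L' ^ 2 ≤ (2 * q') ^ 2 := by gcongr
  have hz : 0 ≤ k * L' := by positivity
  set z := k * L' with hzdef
  have h4 : 2 * z ^ 2 ≤ k * (q' ^ 2 / 8) := by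
    have e1 : 2 * z ^ 2 = 2 * k * (k * L' ^ 2) := by rw [hzdef]; ring
    have e2 : k * L' ^ 2 ≤ k * (2 * q') ^ 2 := by gcongr
    rw [e1]
    have e3 : 0 ≤ k * q' ^ 2 := by positivity
    nlinarith
  have h5 : z + 2 * z ^ 2 ≤ a + u := by nlinarith
  nlinarith [mul_nonneg (sq_nonneg z) (by linarith : (0 : ℝ) ≤ 1 - 2 * z)]

/-- The cone of slopes below `K q` is mapped into itself, if `K` is large. -/
lemma upper_cone_step {a K C q q' : ℝ} (ha : 0 ≤ a) (hq : 0 ≤ q) (hq' : 0 ≤ q') (hC : 0 ≤ C)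
    (haC : a ≤ C * q' ^ 2) (hqq' : q ≤ q' * (1 + C * q')) (hK : 2 * C + 1 ≤ K) :
    slopeMap (a + K * q) ≤ K * q' := by
  have hK0 : 0 ≤ K := by linarith
  have hs : 0 ≤ a + K * q := by positivity
  rcases le_total 1 (K * q') with h | h
  · exact (slopeMap_lt_one hs).le.trans h
  -- monotonicity reduces the claim to the largest slope of the cone
  have h1 : a + K * q ≤ C * q' ^ 2 + K * (q' * (1 + C * q')) := by gcongr
  refine (slopeMap_mono hs h1).trans ?_
  rw [slopeMap_le_iff (by positivity)]
  have h2 : 0 ≤ K * C * q' ^ 2 * q' * K := by positivity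
  have h3 : 0 ≤ C * q' ^ 3 * K := by positivity
  have h4 : (K * C + C) * q' ^ 2 ≤ K ^ 2 * q' ^ 2 := by
    gcongr
    nlinarith
  nlinarith

/-! ### Representatives of points of the circle -/

lemma circleRep_mem (θ : UnitAddCircle) : circleRep θ ∈ Set.Ico (-1 / 2 : ℝ) (-1 / 2 + 1) :=
  (AddCircle.equivIco (1 : ℝ) (-1 / 2) θ).2

lemma coe_circleRep (θ : UnitAddCircle) : (circleRep θ : UnitAddCircle) = θ :=
  AddCircle.coe_equivIco

lemma circleRep_coe {t : ℝ} (ht : |t| < 1 / 2) : circleRep (t : UnitAddCircle) = t := by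
  have := abs_lt.1 ht
  exact AddCircle.equivIco_coe_of_mem ⟨by linarith, by linarith⟩

lemma norm_coe_of_abs_le {t : ℝ} (ht : |t| ≤ 1 / 2) : ‖(t : UnitAddCircle)‖ = |t| := by
  rw [AddCircle.norm_coe_eq_abs_iff (1 : ℝ) one_ne_zero]
  simpa using ht

lemma norm_coe_le_abs (t : ℝ) : ‖(t : UnitAddCircle)‖ ≤ |t| := by
  rw [UnitAddCircle.norm_eq]
  simpa using round_le t 0

lemma abs_circleRep_le (θ : UnitAddCircle) : |circleRep θ| ≤ 1 / 2 := by
  obtain ⟨h1, h2⟩ := circleRep_mem θ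
  exact abs_le.2 ⟨by linarith, by linarith⟩

lemma abs_circleRep (θ : UnitAddCircle) : |circleRep θ| = ‖θ‖ := by
  conv_rhs => rw [← coe_circleRep θ]
  exact (norm_coe_of_abs_le (abs_circleRep_le θ)).symm

lemma circleRep_add {θ φ : UnitAddCircle} (h : ‖θ‖ + ‖φ‖ < 1 / 2) :
    circleRep (θ + φ) = circleRep θ + circleRep φ := by
  conv_lhs => rw [← coe_circleRep θ, ← coe_circleRep φ]
  rw [← AddCircle.coe_add]
  refine circleRep_coe ((abs_add_le _ _).trans_lt ?_)
  rwa [abs_circleRep, abs_circleRep]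

lemma unitAddCircle_norm_le (θ : UnitAddCircle) : ‖θ‖ ≤ 1 / 2 := by
  rw [← abs_circleRep]; exact abs_circleRep_le θ

/-! ### The order of vanishing of `h` and `h'` at the neutral fixed point -/

/-- The derivative of a lift of a circle map is periodic. -/
lemma deriv_lift_add_intCast {h : UnitAddCircle → UnitAddCircle} {H : ℝ → ℝ}
    (H_smooth : ContDiff ℝ ∞ H)
    (H_lift : ∀ t : ℝ, h (t : UnitAddCircle) = (H t : UnitAddCircle)) (m : ℤ) (t : ℝ) :
    deriv H (t + m) = deriv H t := by
  have hcont := H_smooth.continuous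
  have hint : ∀ s, ∃ n : ℤ, H (s + m) - H s = n := by
    intro s
    have : ((H (s + m) - H s : ℝ) : UnitAddCircle) = 0 := by
      rw [AddCircle.coe_sub, ← H_lift, ← H_lift, sub_eq_zero]
      congr 1
      have hm : ((m : ℝ) : UnitAddCircle) = 0 := by
        rw [AddCircle.coe_eq_zero_iff]; exact ⟨m, by simp⟩
      rw [AddCircle.coe_add, hm, add_zero]
    rw [AddCircle.coe_eq_zero_iff] at this
    obtain ⟨n, hn⟩ := this
    exact ⟨n, by rw [← hn]; simp⟩
  have hdisc : IsDiscrete (Set.range ((↑) : ℤ → ℝ)) := isDiscrete_iff_discreteTopology.2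
    (Int.isClosedEmbedding_coe_real.isEmbedding.toHomeomorph.symm.isEmbedding).discreteTopology
  obtain ⟨d, hd⟩ : ∃ d, ∀ s, H (s + m) - H s = d := by
    refine ⟨H (0 + m) - H 0, fun s => ?_⟩
    exact isPreconnected_univ.constant_of_mapsTo (T := Set.range ((↑) : ℤ → ℝ))
      hdisc
      (f := fun s => H (s + m) - H s) (by fun_prop)
      (fun s _ => by obtain ⟨n, hn⟩ := hint s; exact ⟨n, hn.symm⟩) (Set.mem_univ _)
      (Set.mem_univ _)
  have e : (fun s => H (s + m)) = fun s => H s + d := by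
    funext s; linarith [hd s]
  have := congrArg (fun f => deriv f t) e
  simpa [deriv_comp_add_const] using this

/-- A smooth function with a nondegenerate zero minimum at `0` and no other zero in `[-1/2, 1/2]`
is comparable to `t ^ 2` there. -/
lemma exists_quadratic_bounds {f : ℝ → ℝ} (hf : ContDiff ℝ 2 f) (h0 : f 0 = 0)
    (h2 : 0 < iteratedDeriv 2 f 0) (hpos : ∀ t, t ≠ 0 → |t| ≤ 1 / 2 → 0 < f t) :
    ∃ c C : ℝ, 0 < c ∧ 0 ≤ C ∧ ∀ t, |t| ≤ 1 / 2 → c * t ^ 2 ≤ f t ∧ f t ≤ C * t ^ 2 := by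
  have hmin : IsLocalMin f 0 := by
    filter_upwards [Metric.ball_mem_nhds (0 : ℝ) (by norm_num : (0 : ℝ) < 1 / 2)] with t ht
    rw [h0]
    rcases eq_or_ne t 0 with rfl | hne
    · exact h0.ge
    · exact (hpos t hne (by simpa using (mem_ball_zero_iff.1 ht).le)).le
  have h1 : deriv f 0 = 0 := hmin.deriv_eq_zero
  have htaylor := taylor_isLittleO_univ (x₀ := 0) (n := 2) hf
  have htend : Tendsto (fun t => f t / t ^ 2) (𝓝[≠] 0) (𝓝 (iteratedDeriv 2 f 0 / 2)) := by
    have hs := (htaylor.mono (nhdsWithin_le_nhds (s := {0}ᶜ))).tendsto_div_nhds_zero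
    have := hs.add_const (iteratedDeriv 2 f 0 / 2)
    rw [zero_add] at this
    refine this.congr' ?_
    filter_upwards [self_mem_nhdsWithin] with t ht
    have ht : t ≠ 0 := ht
    simp only [taylorWithinEval_succ, taylor_within_zero_eval, iteratedDerivWithin_univ]
    simp [h0, h1]
    field_simp
    ring
  -- the quotient extends continuously over `0`, and compactness bounds it
  let g : ℝ → ℝ := Function.update (fun t => f t / t ^ 2) 0 (iteratedDeriv 2 f 0 / 2)
  have hg : Continuous g := by
    rw [continuous_iff_continuousAt]
    intro t
    rcases eq_or_ne t 0 with rfl | ht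
    · exact continuousAt_update_same.2 htend
    · rw [continuousAt_update_of_ne ht]
      exact hf.continuous.continuousAt.div (by fun_prop) (by positivity)
  have hgpos : ∀ t ∈ Set.Icc (-1 / 2 : ℝ) (1 / 2), 0 < g t := by
    intro t ht
    rcases eq_or_ne t 0 with rfl | hne
    · simp only [g, Function.update_self]; positivity
    · simp only [g, Function.update_of_ne hne]
      have := hpos t hne (abs_le.2 ⟨by linarith [ht.1], ht.2⟩)
      positivity
  have hfg : ∀ t, f t = g t * t ^ 2 := by
    intro t
    rcases eq_or_ne t 0 with rfl | hne
    · simp [h0]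
    · simp only [g, Function.update_of_ne hne]
      field_simp
  have hne : (Set.Icc (-1 / 2 : ℝ) (1 / 2)).Nonempty := ⟨0, by norm_num, by norm_num⟩
  obtain ⟨a, ha, hamin⟩ := isCompact_Icc.exists_isMinOn hne hg.continuousOn
  obtain ⟨b, hb, hbmax⟩ := isCompact_Icc.exists_isMaxOn hne hg.continuousOn
  refine ⟨g a, g b, hgpos a ha, (hgpos b hb).le, fun t ht => ?_⟩
  have ht' : t ∈ Set.Icc (-1 / 2 : ℝ) (1 / 2) := by
    obtain ⟨h1, h2⟩ := abs_le.1 ht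
    exact ⟨by linarith, h2⟩
  rw [hfg t]
  exact ⟨by gcongr; exact hamin ht', by gcongr; exact hbmax ht'⟩

/-- The quantitative content of the hypotheses on `h`: its derivative is comparable to `|x| ^ 2`,
and `h` is of order `|x| ^ 3`. -/
structure CubicTangency (h : UnitAddCircle → UnitAddCircle) (H : ℝ → ℝ) (c C : ℝ) : Prop where
  c_pos : 0 < c
  C_nonneg : 0 ≤ C
  le_deriv : ∀ t : ℝ, c * ‖(t : UnitAddCircle)‖ ^ 2 ≤ deriv H t
  deriv_le : ∀ t : ℝ, deriv H t ≤ C * ‖(t : UnitAddCircle)‖ ^ 2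
  norm_le : ∀ θ, ‖h θ‖ ≤ C * ‖θ‖ ^ 3

theorem exists_cubicTangency {h : UnitAddCircle → UnitAddCircle} {H : ℝ → ℝ}
    (H_smooth : ContDiff ℝ ∞ H)
    (H_lift : ∀ t : ℝ, h (t : UnitAddCircle) = (H t : UnitAddCircle))
    (h_zero : h 0 = 0) (h_neutral : deriv H 0 = 0)
    (h_hyperbolic : ∀ t : ℝ, (t : UnitAddCircle) ≠ 0 → 0 < deriv H t)
    (h_generic : 0 < iteratedDeriv 3 H 0) :
    ∃ c C, CubicTangency h H c C := by
  have hd : ContDiff ℝ 2 (deriv H) := by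
    have : ContDiff ℝ (2 + 1) H := H_smooth.of_le (WithTop.coe_le_coe.2 le_top)
    exact (contDiff_succ_iff_deriv.1 this).2.2
  obtain ⟨c, C, hc, hC, hb⟩ := exists_quadratic_bounds hd h_neutral
    (by rwa [← iteratedDeriv_succ']) (fun t ht ht2 => h_hyperbolic t fun e => ht (by
      rw [← norm_eq_zero, norm_coe_of_abs_le ht2] at e; exact abs_eq_zero.1 e))
  have key : ∀ t : ℝ, c * ‖(t : UnitAddCircle)‖ ^ 2 ≤ deriv H t ∧
      deriv H t ≤ C * ‖(t : UnitAddCircle)‖ ^ 2 := by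
    intro t
    obtain ⟨m, hm⟩ : ∃ m : ℤ, t = circleRep (t : UnitAddCircle) + m := by
      have : ((t - circleRep (t : UnitAddCircle) : ℝ) : UnitAddCircle) = 0 := by
        rw [AddCircle.coe_sub, coe_circleRep, sub_self]
      rw [AddCircle.coe_eq_zero_iff] at this
      obtain ⟨n, hn⟩ := this
      exact ⟨n, by simp at hn; linarith⟩
    have e : deriv H t = deriv H (circleRep (t : UnitAddCircle)) := by
      conv_lhs => rw [hm]
      exact deriv_lift_add_intCast H_smooth H_lift m _
    rw [e, ← abs_circleRep, sq_abs]
    exact hb _ (abs_circleRep_le _)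
  refine ⟨c, C, hc, hC, fun t => (key t).1, fun t => (key t).2, fun θ => ?_⟩
  set t := circleRep θ
  have ht : |t| = ‖θ‖ := abs_circleRep θ
  have e : h θ = ((H t - H 0 : ℝ) : UnitAddCircle) := by
    rw [AddCircle.coe_sub, ← H_lift, ← H_lift, AddCircle.coe_zero, h_zero, sub_zero,
      coe_circleRep]
  rw [e]
  refine (norm_coe_le_abs _).trans ?_
  have hmv := (convex_Icc (-|t|) |t|).norm_image_sub_le_of_norm_deriv_le (f := H)
    (C := C * |t| ^ 2) (x := 0) (y := t)
    (fun x _ => (H_smooth.differentiable (by simp)) x) (fun x hx => ?_) (by simp) (by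
      exact ⟨neg_abs_le t, le_abs_self t⟩)
  · simp only [Real.norm_eq_abs, sub_zero] at hmv
    rw [← ht]
    linarith
  · have h1 : |x| ≤ |t| := abs_le.2 hx
    obtain ⟨h2, h3⟩ := key x
    have h4 : 0 ≤ deriv H x := le_trans (by positivity) h2
    rw [Real.norm_of_nonneg h4]
    refine h3.trans ?_
    have h5 := (norm_coe_le_abs x).trans h1
    gcongr

/-! ### Derivatives of iterates on the torus -/

lemma torusRep_torusProj {v : ℝ × ℝ} (hv : ‖v‖ < 1 / 2) : torusRep (torusProj v) = v := by
  have h := max_lt_iff.1 (Prod.norm_def v ▸ hv)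
  exact Prod.ext (circleRep_coe h.1) (circleRep_coe h.2)

lemma torusProj_torusRep (ξ : Torus) : torusProj (torusRep ξ) = ξ :=
  Prod.ext (coe_circleRep _) (coe_circleRep _)

lemma torusProj_add (v w : ℝ × ℝ) : torusProj (v + w) = torusProj v + torusProj w := rfl

lemma torusProj_sub (v w : ℝ × ℝ) : torusProj (v - w) = torusProj v - torusProj w := rfl

/-- The derivative of a map of the torus is the derivative of any lift. -/
lemma torusDeriv_eq_of_lift {F : Torus → Torus} {G : ℝ × ℝ → ℝ × ℝ}
    (hFG : ∀ v, F (torusProj v) = torusProj (G v)) {w : ℝ × ℝ} {A : (ℝ × ℝ) →L[ℝ] (ℝ × ℝ)}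
    (hG : HasFDerivAt G A w) : torusDeriv F (torusProj w) = A := by
  have h1 : HasFDerivAt (fun v => G (w + v) - G w) A 0 := by
    have h2 : HasFDerivAt G A (w + 0) := by rwa [add_zero]
    simpa using (h2.comp (0 : ℝ × ℝ) ((hasFDerivAt_id _).const_add w)).sub_const (G w)
  refine HasFDerivAt.fderiv (h1.congr_of_eventuallyEq ?_)
  have hc : Tendsto (fun v => G (w + v) - G w) (𝓝 0) (𝓝 0) := by
    simpa using h1.continuousAt.tendsto
  filter_upwards [hc (Metric.ball_mem_nhds 0 (by norm_num : (0 : ℝ) < 1 / 2))] with v hv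
  rw [← torusProj_add, hFG, hFG, ← torusProj_sub, torusRep_torusProj (by simpa using hv)]

lemma iterate_torusProj {F : Torus → Torus} {G : ℝ × ℝ → ℝ × ℝ}
    (hFG : ∀ v, F (torusProj v) = torusProj (G v)) (n : ℕ) (v : ℝ × ℝ) :
    F^[n] (torusProj v) = torusProj (G^[n] v) := by
  induction n with
  | zero => rfl
  | succ n ih => rw [Function.iterate_succ_apply', Function.iterate_succ_apply', ih, hFG]

/-- The chain rule along an orbit. -/
lemma torusDeriv_iterate_succ {F : Torus → Torus} {G : ℝ × ℝ → ℝ × ℝ}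
    (hFG : ∀ v, F (torusProj v) = torusProj (G v)) {A : ℝ × ℝ → (ℝ × ℝ) →L[ℝ] (ℝ × ℝ)}
    (hG : ∀ v, HasFDerivAt G (A v) v) (n : ℕ) (w : ℝ × ℝ) :
    torusDeriv F^[n + 1] (torusProj w) =
      (A (G^[n] w)).comp (torusDeriv F^[n] (torusProj w)) := by
  have key : ∀ n, ∃ B : (ℝ × ℝ) →L[ℝ] (ℝ × ℝ), HasFDerivAt G^[n] B w := by
    intro n
    induction n with
    | zero => exact ⟨_, hasFDerivAt_id w⟩
    | succ n ih =>
      obtain ⟨B, hB⟩ := ih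
      rw [Function.iterate_succ']
      exact ⟨_, (hG _).comp w hB⟩
  obtain ⟨B, hB⟩ := key n
  rw [torusDeriv_eq_of_lift (iterate_torusProj hFG n) hB]
  refine torusDeriv_eq_of_lift (iterate_torusProj hFG (n + 1)) ?_
  rw [Function.iterate_succ']
  exact (hG _).comp w hB

lemma torusDeriv_iterate_zero (F : Torus → Torus) (ξ : Torus) (v : ℝ × ℝ) :
    torusDeriv F^[0] ξ v = v := by
  rw [← torusProj_torusRep ξ]
  have := torusDeriv_eq_of_lift (F := F^[0]) (G := id) (fun v => rfl) (hasFDerivAt_id (torusRep ξ))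
  rw [this]
  rfl

/-- The derivative of `h`, as a function on the circle. -/
noncomputable def circleDeriv (H : ℝ → ℝ) (θ : UnitAddCircle) : ℝ := deriv H (circleRep θ)

lemma circleDeriv_coe {h : UnitAddCircle → UnitAddCircle} {H : ℝ → ℝ}
    (H_smooth : ContDiff ℝ ∞ H)
    (H_lift : ∀ t : ℝ, h (t : UnitAddCircle) = (H t : UnitAddCircle)) (t : ℝ) :
    circleDeriv H (t : UnitAddCircle) = deriv H t := by
  have : ((circleRep (t : UnitAddCircle) - t : ℝ) : UnitAddCircle) = 0 := by
    rw [AddCircle.coe_sub, coe_circleRep, sub_self]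
  rw [AddCircle.coe_eq_zero_iff] at this
  obtain ⟨n, hn⟩ := this
  have e : circleRep (t : UnitAddCircle) = t + n := by simp at hn; linarith
  rw [circleDeriv, e, deriv_lift_add_intCast H_smooth H_lift]

lemma torusDeriv_iterate_map {h : UnitAddCircle → UnitAddCircle} {H : ℝ → ℝ}
    (H_smooth : ContDiff ℝ ∞ H)
    (H_lift : ∀ t : ℝ, h (t : UnitAddCircle) = (H t : UnitAddCircle)) (ξ : Torus) (v : ℝ × ℝ)
    (n : ℕ) {a p r : ℝ} (ha : a = circleDeriv H ((intermittentMap h)^[n] ξ).1)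
    (hpr : torusDeriv (intermittentMap h)^[n] ξ v = (p, r)) :
    torusDeriv (intermittentMap h)^[n + 1] ξ v = (p + a * p + r, a * p + r) := by
  let G : ℝ × ℝ → ℝ × ℝ := fun v => (v.1 + H v.1 + v.2, H v.1 + v.2)
  let A : ℝ × ℝ → (ℝ × ℝ) →L[ℝ] (ℝ × ℝ) := fun v =>
    (.fst ℝ ℝ ℝ + deriv H v.1 • .fst ℝ ℝ ℝ + .snd ℝ ℝ ℝ :
      (ℝ × ℝ) →L[ℝ] ℝ).prod (deriv H v.1 • .fst ℝ ℝ ℝ + .snd ℝ ℝ ℝ)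
  have hFG : ∀ v, intermittentMap h (torusProj v) = torusProj (G v) := by
    intro v
    simp [intermittentMap, torusProj, G, H_lift]
  have hG : ∀ v, HasFDerivAt G (A v) v := by
    intro v
    have hH : HasFDerivAt (fun v : ℝ × ℝ => H v.1) (deriv H v.1 • .fst ℝ ℝ ℝ : (ℝ × ℝ) →L[ℝ] ℝ) v :=
      ((H_smooth.differentiable (by simp)) v.1).hasDerivAt.comp_hasFDerivAt v hasFDerivAt_fst
    exact ((hasFDerivAt_fst.add hH).add hasFDerivAt_snd).prodMk (hH.add hasFDerivAt_snd)
  rw [← torusProj_torusRep ξ] at ha hpr ⊢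
  rw [torusDeriv_iterate_succ hFG hG, ContinuousLinearMap.comp_apply, hpr]
  rw [iterate_torusProj hFG] at ha
  simp only [torusProj, circleDeriv_coe H_smooth H_lift] at ha
  simp [A, ha]

lemma torusDeriv_iterate_symm {h : UnitAddCircle → UnitAddCircle} {H : ℝ → ℝ}
    (H_smooth : ContDiff ℝ ∞ H)
    (H_lift : ∀ t : ℝ, h (t : UnitAddCircle) = (H t : UnitAddCircle)) (ξ : Torus) (v : ℝ × ℝ)
    (n : ℕ) {a p r : ℝ} (ha : a = circleDeriv H ((intermittentMap h).symm^[n + 1] ξ).1)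
    (hpr : torusDeriv (intermittentMap h).symm^[n] ξ v = (p, r)) :
    torusDeriv (intermittentMap h).symm^[n + 1] ξ v = (p - r, r - a * (p - r)) := by
  let G : ℝ × ℝ → ℝ × ℝ := fun v => (v.1 - v.2, v.2 - H (v.1 - v.2))
  let A : ℝ × ℝ → (ℝ × ℝ) →L[ℝ] (ℝ × ℝ) := fun v =>
    (.fst ℝ ℝ ℝ - .snd ℝ ℝ ℝ : (ℝ × ℝ) →L[ℝ] ℝ).prod
      (.snd ℝ ℝ ℝ - deriv H (v.1 - v.2) • (.fst ℝ ℝ ℝ - .snd ℝ ℝ ℝ))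
  have hFG : ∀ v, (intermittentMap h).symm (torusProj v) = torusProj (G v) := by
    intro v
    simp only [intermittentMap, torusProj, G, Equiv.coe_fn_symm_mk, AddCircle.coe_sub, ← H_lift]
  have hG : ∀ v, HasFDerivAt G (A v) v := by
    intro v
    have hs : HasFDerivAt (fun v : ℝ × ℝ => v.1 - v.2)
        (.fst ℝ ℝ ℝ - .snd ℝ ℝ ℝ : (ℝ × ℝ) →L[ℝ] ℝ) v := hasFDerivAt_fst.sub hasFDerivAt_snd
    have hH := ((H_smooth.differentiable (by simp)) (v.1 - v.2)).hasDerivAt.comp_hasFDerivAt v hs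
    exact hs.prodMk (hasFDerivAt_snd.sub hH)
  rw [← torusProj_torusRep ξ] at ha hpr ⊢
  rw [torusDeriv_iterate_succ hFG hG, ContinuousLinearMap.comp_apply, hpr]
  rw [iterate_torusProj hFG, Function.iterate_succ_apply'] at ha
  simp only [torusProj, circleDeriv_coe H_smooth H_lift] at ha
  simp [A, ha, G]

/-- The reversor `(x, y) ↦ (x, - y - h x)`, which conjugates `T` to `T⁻¹`. -/
def reversor (h : UnitAddCircle → UnitAddCircle) (ξ : Torus) : Torus := (ξ.1, -ξ.2 - h ξ.1)

lemma reversor_reversor (h : UnitAddCircle → UnitAddCircle) (ξ : Torus) :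
    reversor h (reversor h ξ) = ξ :=
  Prod.ext rfl (by simp [reversor])

lemma symm_iterate_reversor (h : UnitAddCircle → UnitAddCircle) (n : ℕ) (ξ : Torus) :
    (intermittentMap h).symm^[n] (reversor h ξ) = reversor h ((intermittentMap h)^[n] ξ) := by
  have step : ∀ η, (intermittentMap h).symm (reversor h η) = reversor h (intermittentMap h η) := by
    intro η
    have e : η.1 - (-η.2 - h η.1) = η.1 + h η.1 + η.2 := by abel
    refine Prod.ext ?_ ?_
    · exact e
    · change -η.2 - h η.1 - h (η.1 - (-η.2 - h η.1)) = -(h η.1 + η.2) - h (η.1 + h η.1 + η.2)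
      rw [e]
      abel
  induction n with
  | zero => rfl
  | succ n ih => rw [Function.iterate_succ_apply', Function.iterate_succ_apply', ih, step]

/-! ### Sizes of points of the torus along an orbit -/

/-- The size `√(|x| ^ 2 + |y|)`, comparable to `|x| + √|y|`. Unlike the latter, it changes by at
most a multiple of its square in one step of the map. -/
noncomputable def quadSize (ξ : Torus) : ℝ := Real.sqrt (‖ξ.1‖ ^ 2 + ‖ξ.2‖)

lemma quadSize_nonneg (ξ : Torus) : 0 ≤ quadSize ξ := Real.sqrt_nonneg _

lemma quadSize_sq (ξ : Torus) : quadSize ξ ^ 2 = ‖ξ.1‖ ^ 2 + ‖ξ.2‖ := Real.sq_sqrt (by positivity)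

lemma quadSize_le_one (ξ : Torus) : quadSize ξ ≤ 1 := by
  refine Real.sqrt_le_one.2 ?_
  have h1 := unitAddCircle_norm_le ξ.1
  have h2 := unitAddCircle_norm_le ξ.2
  have h3 : ‖ξ.1‖ ^ 2 ≤ (1 / 2) ^ 2 := by gcongr
  linarith

lemma norm_fst_le_quadSize (ξ : Torus) : ‖ξ.1‖ ≤ quadSize ξ :=
  Real.le_sqrt_of_sq_le (by linarith [norm_nonneg ξ.2])

lemma norm_snd_le_quadSize_sq (ξ : Torus) : ‖ξ.2‖ ≤ quadSize ξ ^ 2 := by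
  rw [quadSize_sq]; linarith [sq_nonneg ‖ξ.1‖]

lemma quadSize_pos {ξ : Torus} (hξ : ξ ≠ 0) : 0 < quadSize ξ := by
  refine (quadSize_nonneg ξ).lt_of_ne fun e => hξ ?_
  have h1 := norm_fst_le_quadSize ξ
  have h2 := norm_snd_le_quadSize_sq ξ
  rw [← e] at h1 h2
  exact Prod.ext (norm_le_zero_iff.1 h1) (norm_le_zero_iff.1 (by simpa using h2))

lemma quadSize_le_parabolicSize (ξ : Torus) : quadSize ξ ≤ parabolicSize ξ := by
  refine Real.sqrt_le_iff.2 ⟨by unfold parabolicSize; positivity, ?_⟩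
  have h1 := Real.sq_sqrt (norm_nonneg ξ.2)
  have h2 := mul_nonneg (norm_nonneg ξ.1) (Real.sqrt_nonneg ‖ξ.2‖)
  unfold parabolicSize
  nlinarith

lemma parabolicSize_le_quadSize (ξ : Torus) : parabolicSize ξ ≤ 2 * quadSize ξ := by
  have : Real.sqrt ‖ξ.2‖ ≤ quadSize ξ := Real.sqrt_le_sqrt (by linarith [sq_nonneg ‖ξ.1‖])
  unfold parabolicSize
  linarith [norm_fst_le_quadSize ξ]

lemma intermittentMap_fst (h : UnitAddCircle → UnitAddCircle) (ξ : Torus) :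
    (intermittentMap h ξ).1 = ξ.1 + (intermittentMap h ξ).2 := by
  change ξ.1 + h ξ.1 + ξ.2 = ξ.1 + (h ξ.1 + ξ.2)
  abel

lemma intermittentMap_snd (h : UnitAddCircle → UnitAddCircle) (ξ : Torus) :
    (intermittentMap h ξ).2 = ξ.2 + h ξ.1 := add_comm _ _

/-- A constant controlling the change of `quadSize` in one step. -/
def stepConst (C : ℝ) : ℝ := 3 + 8 * C + C ^ 2

namespace CubicTangency

variable {h : UnitAddCircle → UnitAddCircle} {H : ℝ → ℝ} {c C : ℝ}

lemma stepConst_nonneg (hh : CubicTangency h H c C) : 0 ≤ stepConst C := by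
  have := hh.C_nonneg
  unfold stepConst; positivity

lemma quadSize_map_le (hh : CubicTangency h H c C) (ξ : Torus) :
    quadSize (intermittentMap h ξ) ≤ quadSize ξ * (1 + stepConst C * quadSize ξ) := by
  refine le_mul_of_sq_le_cube (quadSize_nonneg _) hh.stepConst_nonneg ?_
  rw [quadSize_sq (intermittentMap h ξ), intermittentMap_fst]
  have hC := hh.C_nonneg
  set q := quadSize ξ
  have hq0 : 0 ≤ q := quadSize_nonneg ξ
  have hq1 : q ≤ 1 := quadSize_le_one ξ
  have hx : ‖ξ.1‖ ≤ q := norm_fst_le_quadSize ξ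
  have hq : q ^ 2 = ‖ξ.1‖ ^ 2 + ‖ξ.2‖ := quadSize_sq ξ
  have hk : ‖h ξ.1‖ ≤ C * q ^ 3 := (hh.norm_le ξ.1).trans (by gcongr)
  have hy : ‖(intermittentMap h ξ).2‖ ≤ ‖ξ.2‖ + C * q ^ 3 := by
    rw [intermittentMap_snd]
    exact (norm_add_le _ _).trans (by linarith)
  have h32 : q ^ 3 ≤ q ^ 2 := pow_le_pow_of_le_one hq0 hq1 (by norm_num)
  have h43 : q ^ 4 ≤ q ^ 3 := pow_le_pow_of_le_one hq0 hq1 (by norm_num)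
  have hy2 : ‖(intermittentMap h ξ).2‖ ≤ (1 + C) * q ^ 2 := by
    have : C * q ^ 3 ≤ C * q ^ 2 := by gcongr
    linarith [norm_snd_le_quadSize_sq ξ]
  set y' := (intermittentMap h ξ).2
  have hxx : ‖ξ.1 + y'‖ ^ 2 ≤ (‖ξ.1‖ + ‖y'‖) ^ 2 := by gcongr; exact norm_add_le _ _
  have h1 : ‖ξ.1‖ * ‖y'‖ ≤ q * ((1 + C) * q ^ 2) := by gcongr
  have h2 : ‖y'‖ ^ 2 ≤ ((1 + C) * q ^ 2) ^ 2 := by gcongr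
  have h3 : (1 + C) ^ 2 * q ^ 4 ≤ (1 + C) ^ 2 * q ^ 3 := by gcongr
  have h4 : 0 ≤ C * q ^ 3 := by positivity
  unfold stepConst
  linarith

lemma quadSize_le_map (hh : CubicTangency h H c C) (ξ : Torus) :
    quadSize ξ ≤
      quadSize (intermittentMap h ξ) * (1 + stepConst C * quadSize (intermittentMap h ξ)) := by
  refine le_mul_of_sq_le_cube (quadSize_nonneg _) hh.stepConst_nonneg ?_
  rw [quadSize_sq ξ]
  have hC := hh.C_nonneg
  have hX := intermittentMap_fst h ξ
  have hY := intermittentMap_snd h ξ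
  set ζ := intermittentMap h ξ
  set q := quadSize ζ
  have hq0 : 0 ≤ q := quadSize_nonneg ζ
  have hq1 : q ≤ 1 := quadSize_le_one ζ
  have hx : ‖ζ.1‖ ≤ q := norm_fst_le_quadSize ζ
  have hy : ‖ζ.2‖ ≤ q ^ 2 := norm_snd_le_quadSize_sq ζ
  have hq : q ^ 2 = ‖ζ.1‖ ^ 2 + ‖ζ.2‖ := quadSize_sq ζ
  have h21 : q ^ 2 ≤ q := by nlinarith
  have h43 : q ^ 4 ≤ q ^ 3 := pow_le_pow_of_le_one hq0 hq1 (by norm_num)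
  have h1 : ‖ξ.1‖ ≤ ‖ζ.1‖ + ‖ζ.2‖ := by
    rw [eq_sub_of_add_eq hX.symm]; exact norm_sub_le _ _
  have hk : ‖h ξ.1‖ ≤ C * (2 * q) ^ 3 := by
    refine (hh.norm_le ξ.1).trans ?_
    have : ‖ξ.1‖ ≤ 2 * q := by linarith
    gcongr
  have h2 : ‖ξ.2‖ ≤ ‖ζ.2‖ + ‖h ξ.1‖ := by
    rw [eq_sub_of_add_eq hY.symm]; exact norm_sub_le _ _
  have h3 : ‖ξ.1‖ ^ 2 ≤ (‖ζ.1‖ + ‖ζ.2‖) ^ 2 := by gcongr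
  have h4 : ‖ζ.1‖ * ‖ζ.2‖ ≤ q * q ^ 2 := by gcongr
  have h5 : ‖ζ.2‖ ^ 2 ≤ (q ^ 2) ^ 2 := by gcongr
  have h6 : 0 ≤ C ^ 2 * q ^ 3 := by positivity
  unfold stepConst
  linarith

lemma quadSize_reversor_le (hh : CubicTangency h H c C) (ξ : Torus) :
    quadSize (reversor h ξ) ≤ (1 + C) * quadSize ξ := by
  have hC := hh.C_nonneg
  have hq0 := quadSize_nonneg ξ
  have hq1 := quadSize_le_one ξ
  have h1 : quadSize (reversor h ξ) ≤ quadSize ξ * (1 + C * quadSize ξ) := by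
    refine le_mul_of_sq_le_cube hq0 hC ?_
    rw [quadSize_sq (reversor h ξ), quadSize_sq ξ]
    have h2 : ‖-ξ.2 - h ξ.1‖ ≤ ‖ξ.2‖ + ‖h ξ.1‖ := by
      simpa using norm_sub_le (-ξ.2) (h ξ.1)
    have h3 : ‖h ξ.1‖ ≤ C * quadSize ξ ^ 3 := by
      refine (hh.norm_le ξ.1).trans ?_
      have := norm_fst_le_quadSize ξ
      gcongr
    simp only [reversor]
    linarith
  refine h1.trans ?_
  rw [mul_comm]
  gcongr
  exact mul_le_of_le_one_right hC hq1

lemma circleDeriv_bounds (hh : CubicTangency h H c C) (θ : UnitAddCircle) :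
    c * ‖θ‖ ^ 2 ≤ circleDeriv H θ ∧ circleDeriv H θ ≤ C * ‖θ‖ ^ 2 := by
  have h1 := hh.le_deriv (circleRep θ)
  have h2 := hh.deriv_le (circleRep θ)
  rw [coe_circleRep] at h1 h2
  exact ⟨h1, h2⟩

lemma circleDeriv_nonneg (hh : CubicTangency h H c C) (θ : UnitAddCircle) :
    0 ≤ circleDeriv H θ :=
  le_trans (by have := hh.c_pos; positivity) (hh.circleDeriv_bounds θ).1

lemma circleDeriv_le_quadSize_sq (hh : CubicTangency h H c C) (ξ : Torus) :
    circleDeriv H ξ.1 ≤ C * quadSize ξ ^ 2 := by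
  refine (hh.circleDeriv_bounds ξ.1).2.trans ?_
  have := hh.C_nonneg
  have := norm_fst_le_quadSize ξ
  gcongr

/-- An orbit cannot spend two consecutive times near the axis `x = 0` without being near the
origin: there `y = x₁ - x₀`. -/
lemma exists_le_circleDeriv_add (hh : CubicTangency h H c C) {δ : ℝ} (hδ0 : 0 < δ) :
    ∃ m, 0 < m ∧ ∀ ξ, δ ≤ quadSize (intermittentMap h (intermittentMap h ξ)) →
      m ≤ circleDeriv H (intermittentMap h ξ).1 + circleDeriv H ξ.1 := by
  have hD := hh.stepConst_nonneg
  have hc := hh.c_pos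
  set D := stepConst C
  obtain ⟨s, hs0, hs1, hs⟩ : ∃ s : ℝ, 0 < s ∧ s ≤ 1 ∧ (1 + D) ^ 2 * (3 * s) < δ ^ 2 := by
    refine ⟨min 1 (δ ^ 2 / (4 * (1 + D) ^ 2)), by positivity, min_le_left _ _, ?_⟩
    have h1 := min_le_right 1 (δ ^ 2 / (4 * (1 + D) ^ 2))
    rw [le_div_iff₀ (by positivity)] at h1
    have : 0 < δ ^ 2 := by positivity
    linarith
  refine ⟨c * s ^ 2, by positivity, fun ξ hξ => ?_⟩
  by_contra! hlt
  set ζ := intermittentMap h ξ with hζ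
  have b1 := (hh.circleDeriv_bounds ξ.1).1
  have b2 := (hh.circleDeriv_bounds ζ.1).1
  have n1 := hh.circleDeriv_nonneg ξ.1
  have n2 := hh.circleDeriv_nonneg ζ.1
  have x1 : ‖ξ.1‖ ≤ s := by
    refine le_of_sq_le_sq ?_ hs0.le
    exact le_of_mul_le_mul_left (by linarith) hc
  have x2 : ‖ζ.1‖ ≤ s := by
    refine le_of_sq_le_sq ?_ hs0.le
    exact le_of_mul_le_mul_left (by linarith) hc
  have y2 : ‖ζ.2‖ ≤ 2 * s := by
    have e : ζ.2 = ζ.1 - ξ.1 := by rw [hζ, intermittentMap_fst]; abel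
    rw [e]
    linarith [norm_sub_le ζ.1 ξ.1]
  have hq : quadSize ζ ^ 2 ≤ 3 * s := by
    rw [quadSize_sq]
    nlinarith [norm_nonneg ζ.1]
  have hq0 := quadSize_nonneg ζ
  have h1 : δ ≤ (1 + D) * quadSize ζ := by
    refine (hξ.trans (hh.quadSize_map_le ζ)).trans ?_
    rw [mul_comm]
    gcongr
    exact mul_le_of_le_one_right hD (quadSize_le_one ζ)
  have h2 : δ ^ 2 ≤ ((1 + D) * quadSize ζ) ^ 2 := by gcongr
  rw [mul_pow] at h2
  have h3 : (1 + D) ^ 2 * quadSize ζ ^ 2 ≤ (1 + D) ^ 2 * (3 * s) := by gcongr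
  linarith

end CubicTangency

/-! ### The cone of unstable slopes -/

/-- The Lyapunov function `q - x y / (2 q ^ 2)` of `lyapunov_step`, on the torus. -/
noncomputable def lyapunov (ξ : Torus) : ℝ :=
  quadSize ξ - circleRep ξ.1 * circleRep ξ.2 / (2 * quadSize ξ ^ 2)

lemma lyapunov_bounds (ξ : Torus) :
    quadSize ξ / 2 ≤ lyapunov ξ ∧ lyapunov ξ ≤ 2 * quadSize ξ := by
  have hq0 := quadSize_nonneg ξ
  have key : |circleRep ξ.1 * circleRep ξ.2 / (2 * quadSize ξ ^ 2)| ≤ quadSize ξ / 2 := by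
    rw [abs_div, abs_mul, abs_circleRep, abs_circleRep,
      abs_of_nonneg (by positivity : 0 ≤ 2 * quadSize ξ ^ 2)]
    refine div_le_of_le_mul₀ (by positivity) (by positivity) ?_
    calc ‖ξ.1‖ * ‖ξ.2‖ ≤ quadSize ξ * quadSize ξ ^ 2 := by
          gcongr
          exacts [norm_fst_le_quadSize ξ, norm_snd_le_quadSize_sq ξ]
      _ = _ := by ring
  have := abs_le.1 key
  unfold lyapunov
  constructor <;> linarith

namespace CubicTangency

variable {h : UnitAddCircle → UnitAddCircle} {H : ℝ → ℝ} {c C : ℝ}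

lemma lyapunov_map_le (hh : CubicTangency h H c C) (ξ : Torus)
    (hsmall : 100 * (1 + C) * quadSize (intermittentMap h ξ) ≤ 1) :
    lyapunov (intermittentMap h ξ) ≤ lyapunov ξ + (24 + 4 * C) * ‖ξ.1‖ ^ 2 -
      quadSize (intermittentMap h ξ) ^ 2 / 8 := by
  have hC := hh.C_nonneg
  have hX := intermittentMap_fst h ξ
  have hY := intermittentMap_snd h ξ
  set ζ := intermittentMap h ξ
  have hq0 := quadSize_nonneg ζ
  have hx := norm_fst_le_quadSize ζ
  have hy := norm_snd_le_quadSize_sq ζ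
  have hCq : 0 ≤ C * quadSize ζ := by positivity
  have h21 : quadSize ζ ^ 2 ≤ quadSize ζ := by nlinarith
  have h1 : ‖ξ.1‖ ≤ ‖ζ.1‖ + ‖ζ.2‖ := by
    rw [eq_sub_of_add_eq hX.symm]; exact norm_sub_le _ _
  have h2 : ‖ξ.2‖ ≤ ‖ζ.2‖ + ‖h ξ.1‖ := by
    rw [eq_sub_of_add_eq hY.symm]; exact norm_sub_le _ _
  have hk : ‖h ξ.1‖ ≤ C * (2 * quadSize ζ) := by
    refine (hh.norm_le ξ.1).trans ?_
    have h3 : ‖ξ.1‖ ≤ 2 * quadSize ζ := by linarith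
    have h4 : ‖ξ.1‖ ^ 3 ≤ ‖ξ.1‖ :=
      pow_le_of_le_one (norm_nonneg _) (by linarith [unitAddCircle_norm_le ξ.1]) (by norm_num)
    gcongr
    linarith
  -- near the origin the coordinates in `[-1/2, 1/2)` are additive
  have hX' : circleRep ζ.1 = circleRep ξ.1 + circleRep ζ.2 := by
    rw [hX]; exact circleRep_add (by linarith)
  have hY' : circleRep ζ.2 = circleRep ξ.2 + circleRep (h ξ.1) := by
    rw [hY]; exact circleRep_add (by linarith)
  have := lyapunov_step hC (x := circleRep ξ.1) (y := circleRep ξ.2) (k := circleRep (h ξ.1))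
    (q := quadSize ξ) (q' := quadSize ζ)
    (by rw [abs_circleRep, abs_circleRep]; exact hh.norm_le _) hY' hX' (quadSize_nonneg _) hq0
    (by rw [quadSize_sq, ← sq_abs (circleRep ξ.1), abs_circleRep, abs_circleRep])
    (by rw [quadSize_sq, ← sq_abs (circleRep ζ.1), abs_circleRep, abs_circleRep]) hsmall
  rw [← sq_abs (circleRep ξ.1), abs_circleRep] at this
  exact this

/-- Along every backward orbit there is an invariant sequence of slopes comparable to the sizes
of the points of the orbit. -/
theorem exists_unstable_slopes (hh : CubicTangency h H c C) :
    ∃ k K : ℝ, 0 < k ∧ 0 < K ∧ ∀ ξ : ℕ → Torus, (∀ n, intermittentMap h (ξ (n + 1)) = ξ n) →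
      ∃ u : ℕ → ℝ, ∀ n, 0 ≤ u n ∧ k * quadSize (ξ n) ≤ u n ∧ u n ≤ K * quadSize (ξ n) ∧
        u n = slopeMap (circleDeriv H (ξ (n + 1)).1 + u (n + 1)) := by
  have hC := hh.C_nonneg
  have hc := hh.c_pos
  have hD := hh.stepConst_nonneg
  set D := stepConst C
  set δ : ℝ := 1 / (100 * (1 + C)) with hδ
  have hδ0 : 0 < δ := by positivity
  obtain ⟨m, hm0, hm⟩ := hh.exists_le_circleDeriv_add hδ0
  have slope_pos : ∀ {s : ℝ}, 0 < s → 0 < slopeMap s := fun {s} hs => by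
    unfold slopeMap; positivity
  -- a lower bound for slopes at points away from the origin
  set s₀ := min (slopeMap (slopeMap m)) (slopeMap (δ / (1 + D))) with hs₀
  have hs₀pos : 0 < s₀ := lt_min (slope_pos (slope_pos hm0)) (slope_pos (by positivity))
  set M := 24 + 4 * C
  have hM : 0 < M := by positivity
  set k := min (1 / 64) (min (c / M) (s₀ / 2))
  have hk0 : 0 < k := by positivity
  have hk64 : k ≤ 1 / 64 := min_le_left _ _
  have hkM : k * M ≤ c := by
    rw [← le_div_iff₀ hM]; exact (min_le_right _ _).trans (min_le_left _ _)
  have hks : k * 2 ≤ s₀ := by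
    rw [← le_div_iff₀ two_pos]; exact (min_le_right _ _).trans (min_le_right _ _)
  set E := C * (1 + D) ^ 2 + D
  have hE : 0 ≤ E := by positivity
  set K := 2 * E + 1 with hKdef
  have hK1 : 1 ≤ K := by linarith
  refine ⟨k / 2, K, by positivity, by positivity, fun ξ hξ => ?_⟩
  set a : ℕ → ℝ := fun n => circleDeriv H (ξ n).1 with hadef
  have ha : ∀ n, 0 ≤ a n := fun n => hh.circleDeriv_nonneg _
  have hq0 : ∀ n, 0 ≤ quadSize (ξ n) := fun n => quadSize_nonneg _
  have hq1 : ∀ n, quadSize (ξ n) ≤ 1 := fun n => quadSize_le_one _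
  have hup0 : ∀ n, 0 ≤ K * quadSize (ξ n) := fun n => mul_nonneg (by linarith) (hq0 n)
  have hstep_back : ∀ n,
      quadSize (ξ (n + 1)) ≤ quadSize (ξ n) * (1 + D * quadSize (ξ n)) := fun n => by
    simpa only [hξ] using hh.quadSize_le_map (ξ (n + 1))
  have hback : ∀ n, quadSize (ξ (n + 1)) ≤ (1 + D) * quadSize (ξ n) := by
    intro n
    refine (hstep_back n).trans ?_
    rw [mul_comm]
    have := hq0 n
    gcongr
    exact mul_le_of_le_one_right hD (hq1 _)
  have hforw : ∀ n, quadSize (ξ n) ≤ (1 + D) * quadSize (ξ (n + 1)) := by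
    intro n
    have := hh.quadSize_map_le (ξ (n + 1))
    rw [hξ] at this
    refine this.trans ?_
    rw [mul_comm]
    have := hq0 (n + 1)
    gcongr
    exact mul_le_of_le_one_right hD (hq1 _)
  have hpull0 : ∀ N n, 0 ≤ pulledSlope a (fun n => K * quadSize (ξ n)) N n := by
    intro N
    induction N with
    | zero => exact hup0
    | succ N ih => exact fun n => slopeMap_nonneg (add_nonneg (ha _) (ih _))
  have hup : ∀ n, slopeMap (a (n + 1) + K * quadSize (ξ (n + 1))) ≤ K * quadSize (ξ n) := by
    intro n
    refine upper_cone_step (ha _) (hq0 _) (hq0 _) hE ?_ ?_ hKdef.ge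
    · calc a (n + 1) ≤ C * quadSize (ξ (n + 1)) ^ 2 := hh.circleDeriv_le_quadSize_sq _
        _ ≤ C * ((1 + D) * quadSize (ξ n)) ^ 2 := by
            have := hq0 (n + 1)
            gcongr
            exact hback n
        _ = C * (1 + D) ^ 2 * quadSize (ξ n) ^ 2 := by ring
        _ ≤ E * quadSize (ξ n) ^ 2 := by gcongr; simp only [E]; linarith
    · refine (hstep_back n).trans ?_
      have := hq0 n
      gcongr
      simp only [E]
      linarith [mul_nonneg hC (sq_nonneg (1 + D))]
  have hL0 : ∀ n, 0 ≤ lyapunov (ξ n) := fun n => by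
    linarith [(lyapunov_bounds (ξ n)).1, hq0 n]
  have hL2 : ∀ n, lyapunov (ξ n) ≤ 2 := fun n => by
    linarith [(lyapunov_bounds (ξ n)).2, hq1 n]
  have hlo : ∀ N n, k * lyapunov (ξ n) ≤ pulledSlope a (fun n => K * quadSize (ξ n)) N n := by
    intro N
    induction N with
    | zero =>
      intro n
      have h1 := (lyapunov_bounds (ξ n)).2
      calc k * lyapunov (ξ n) ≤ 1 / 64 * (2 * quadSize (ξ n)) := by
            gcongr
            exact hL0 n
        _ ≤ 1 * quadSize (ξ n) := by linarith [hq0 n]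
        _ ≤ K * quadSize (ξ n) := by have := hq0 n; gcongr
    | succ N ih =>
      intro n
      rcases le_total (quadSize (ξ n)) δ with hn | hn
      · -- near the origin, by the Lyapunov function
        have hsmall : 100 * (1 + C) * quadSize (ξ n) ≤ 1 := by
          rw [hδ, le_div_iff₀ (by positivity)] at hn
          linarith
        have hlyap := hh.lyapunov_map_le (ξ (n + 1)) (by rwa [hξ])
        rw [hξ] at hlyap
        refine lower_cone_step (ha _) (hpull0 _ _) (hh.circleDeriv_bounds _).1 (ih _) hk0.le
          (by linarith) hkM (hL0 n) (lyapunov_bounds _).2 ?_ hlyap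
        nlinarith [hL2 n, hL0 n]
      · -- away from the origin, by the expansion in the last two steps
        have hks' : k * lyapunov (ξ n) ≤ s₀ :=
          le_trans (by have := hL2 n; gcongr) hks
        refine hks'.trans ?_
        cases N with
        | zero =>
          refine (min_le_right _ _).trans (slopeMap_mono (by positivity) ?_)
          have h1 : δ / (1 + D) ≤ quadSize (ξ (n + 1)) := by
            rw [div_le_iff₀ (by positivity)]
            linarith [hforw n]
          have h2 : 1 * quadSize (ξ (n + 1)) ≤ K * quadSize (ξ (n + 1)) := by
            have := hq0 (n + 1); gcongr
          change δ / (1 + D) ≤ a (n + 1) + K * quadSize (ξ (n + 1))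
          linarith [ha (n + 1)]
        | succ N =>
          refine (min_le_left _ _).trans (slopeMap_mono (slopeMap_nonneg hm0.le) ?_)
          have h1 : m ≤ a (n + 1) + a (n + 2) := by
            simpa only [hξ] using hm (ξ (n + 2)) (by rwa [hξ, hξ])
          calc slopeMap m ≤ slopeMap (a (n + 1) + a (n + 2)) := slopeMap_mono hm0.le h1
            _ ≤ slopeMap (a (n + 1)) + slopeMap (a (n + 2)) := slopeMap_add_le (ha _) (ha _)
            _ ≤ _ := add_le_add (slopeMap_le_self (ha _))
                (slopeMap_mono (ha _) (le_add_of_nonneg_right (hpull0 _ _)))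
  obtain ⟨u, hu⟩ := exists_invariant_slopes ha hup0 hup hlo
  refine ⟨u, fun n => ?_⟩
  obtain ⟨h1, h2, h3, h4⟩ := hu n
  refine ⟨h1, ?_, h3, h4⟩
  have := mul_le_mul_of_nonneg_left (lyapunov_bounds (ξ n)).1 hk0.le
  linarith

end CubicTangency

/-! ### The unstable and stable spaces -/

lemma mem_span_slope_iff (s : ℝ) (v : ℝ × ℝ) :
    v ∈ Submodule.span ℝ {((1, s) : ℝ × ℝ)} ↔ v.2 = s * v.1 := by
  rw [Submodule.mem_span_singleton]
  constructor
  · rintro ⟨b, rfl⟩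
    simp [mul_comm]
  · intro e
    exact ⟨v.1, Prod.ext (by simp) (by simp [e, mul_comm])⟩

lemma mem_boundedSpace_iff {A : ℕ → (ℝ × ℝ) →L[ℝ] (ℝ × ℝ)} {v : ℝ × ℝ} :
    v ∈ boundedSpace A ↔ ∃ B, ∀ n, |(A n v).1| ≤ B ∧ |(A n v).2| ≤ B :=
  exists_congr fun _ => forall_congr' fun _ => norm_prod_le_iff

/-- Slopes `u` along a sequence of points, comparable to the sizes of the points and invariant
under the derivative. -/
structure IsSlopeSequence (H : ℝ → ℝ) (k K : ℝ) (ξ : ℕ → Torus) (u : ℕ → ℝ) : Prop where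
  nonneg : ∀ n, 0 ≤ u n
  lower : ∀ n, k * quadSize (ξ n) ≤ u n
  upper : ∀ n, u n ≤ K * quadSize (ξ n)
  invariant : ∀ n, u n = slopeMap (circleDeriv H (ξ (n + 1)).1 + u (n + 1))

lemma map_symm_iterate_succ (h : UnitAddCircle → UnitAddCircle) (ξ : Torus) (n : ℕ) :
    intermittentMap h ((intermittentMap h).symm^[n + 1] ξ) = (intermittentMap h).symm^[n] ξ := by
  rw [Function.iterate_succ_apply', Equiv.apply_symm_apply]

lemma symm_iterate_reversor_fst (h : UnitAddCircle → UnitAddCircle) (n : ℕ) (ξ : Torus) :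
    ((intermittentMap h).symm^[n] (reversor h ξ)).1 = ((intermittentMap h)^[n] ξ).1 := by
  rw [symm_iterate_reversor]
  rfl

section

variable {h : UnitAddCircle → UnitAddCircle} {H : ℝ → ℝ} {c C k K : ℝ} {ξ : Torus} {u : ℕ → ℝ}

/-- Under the derivatives of `T⁻ⁿ` tangent vectors perform a backward transport. -/
lemma isBackwardTransport_symm (H_smooth : ContDiff ℝ ∞ H)
    (H_lift : ∀ t : ℝ, h (t : UnitAddCircle) = (H t : UnitAddCircle)) (v : ℝ × ℝ) :
    IsBackwardTransport (fun n => circleDeriv H ((intermittentMap h).symm^[n] ξ).1)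
      (fun n => (torusDeriv (intermittentMap h).symm^[n] ξ v).1)
      (fun n => (torusDeriv (intermittentMap h).symm^[n] ξ v).2) := by
  intro n
  have := torusDeriv_iterate_symm H_smooth H_lift ξ v n rfl Prod.mk.eta.symm
  simp only [this, and_self]

/-- The derivative of the reversor turns the derivatives of `Tⁿ` at `ξ` into a backward transport
along the backward orbit of the reversed point. -/
lemma isBackwardTransport_reversor (H_smooth : ContDiff ℝ ∞ H)
    (H_lift : ∀ t : ℝ, h (t : UnitAddCircle) = (H t : UnitAddCircle)) (v : ℝ × ℝ) :
    IsBackwardTransport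
      (fun n => circleDeriv H ((intermittentMap h).symm^[n] (reversor h ξ)).1)
      (fun n => (torusDeriv (intermittentMap h)^[n] ξ v).1)
      (fun n => -(torusDeriv (intermittentMap h)^[n] ξ v).2 -
        circleDeriv H ((intermittentMap h).symm^[n] (reversor h ξ)).1 *
          (torusDeriv (intermittentMap h)^[n] ξ v).1) := by
  intro n
  have := torusDeriv_iterate_map H_smooth H_lift ξ v n rfl Prod.mk.eta.symm
  simp only [symm_iterate_reversor_fst, this]
  constructor <;> ring

/-- The unstable space is the line with the invariant slope, and is contracted in the past. -/
theorem unstableSpace_of_slopes (hh : CubicTangency h H c C) (H_smooth : ContDiff ℝ ∞ H)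
    (H_lift : ∀ t : ℝ, h (t : UnitAddCircle) = (H t : UnitAddCircle)) (hk : 0 < k)
    (hu : IsSlopeSequence H k K (fun n => (intermittentMap h).symm^[n] ξ) u) :
    unstableSpace (intermittentMap h) ξ = Submodule.span ℝ {(1, u 0)} ∧
      (ξ ≠ 0 → ∀ v ∈ unstableSpace (intermittentMap h) ξ,
        Tendsto (fun n : ℕ => torusDeriv (intermittentMap h).symm^[n] ξ v) atTop (𝓝 0)) := by
  have ha : ∀ n, 0 ≤ circleDeriv H ((intermittentMap h).symm^[n] ξ).1 :=
    fun n => hh.circleDeriv_nonneg _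
  have hmem : ∀ v, v ∈ unstableSpace (intermittentMap h) ξ ↔ v.2 = u 0 * v.1 := by
    intro v
    rw [unstableSpace, mem_boundedSpace_iff]
    refine ((isBackwardTransport_symm H_smooth H_lift v).bounded_iff ha hu.nonneg
      hu.invariant).trans ?_
    simp only [torusDeriv_iterate_zero]
  refine ⟨Submodule.ext fun v => (hmem v).trans (mem_span_slope_iff _ _).symm,
    fun hξ v hv => ?_⟩
  have := (isBackwardTransport_symm H_smooth H_lift v).tendsto_zero ha hu.nonneg hu.invariant
    (by simpa only [torusDeriv_iterate_zero] using (hmem v).1 hv) hk hh.stepConst_nonneg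
    (fun n => quadSize_nonneg ((intermittentMap h).symm^[n] ξ)) (quadSize_pos hξ)
    (fun n => by
      simpa only [map_symm_iterate_succ] using
        hh.quadSize_map_le ((intermittentMap h).symm^[n + 1] ξ))
    hu.lower
  exact this.1.prodMk_nhds this.2

/-- The stable space at `ξ` is the image, under the derivative of the reversor, of the line with
the invariant slope at the reversed point; it is contracted in the future. -/
theorem stableSpace_of_slopes (hh : CubicTangency h H c C) (H_smooth : ContDiff ℝ ∞ H)
    (H_lift : ∀ t : ℝ, h (t : UnitAddCircle) = (H t : UnitAddCircle)) (hk : 0 < k)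
    (hu : IsSlopeSequence H k K (fun n => (intermittentMap h).symm^[n] (reversor h ξ)) u) :
    stableSpace (intermittentMap h) ξ = Submodule.span ℝ {(1, -(circleDeriv H ξ.1 + u 0))} ∧
      (ξ ≠ 0 → ∀ v ∈ stableSpace (intermittentMap h) ξ,
        Tendsto (fun n : ℕ => torusDeriv (intermittentMap h)^[n] ξ v) atTop (𝓝 0)) := by
  set a : ℕ → ℝ := fun n => circleDeriv H ((intermittentMap h).symm^[n] (reversor h ξ)).1
    with hadef
  have ha : ∀ n, 0 ≤ a n := fun n => hh.circleDeriv_nonneg _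
  have haC : ∀ n, a n ≤ C := fun n =>
    (hh.circleDeriv_le_quadSize_sq _).trans (mul_le_of_le_one_right hh.C_nonneg
      (pow_le_one₀ (quadSize_nonneg _) (quadSize_le_one _)))
  have ha0 : a 0 = circleDeriv H ξ.1 := rfl
  have hmul : ∀ n (p B : ℝ), |p| ≤ B → |a n * p| ≤ C * B := fun n p B hp => by
    rw [abs_mul, abs_of_nonneg (ha n)]
    have := haC n
    have := hh.C_nonneg
    gcongr
  have hmem : ∀ v, v ∈ stableSpace (intermittentMap h) ξ ↔
      v.2 = -(circleDeriv H ξ.1 + u 0) * v.1 := by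
    intro v
    have hiff := (isBackwardTransport_reversor (ξ := ξ) H_smooth H_lift v).bounded_iff ha
      hu.nonneg hu.invariant
    simp only [torusDeriv_iterate_zero] at hiff
    rw [stableSpace, mem_boundedSpace_iff]
    -- the derivative of the reversor is bounded along the orbit, and is an involution
    have hshear : (∃ B, ∀ n, |(torusDeriv (intermittentMap h)^[n] ξ v).1| ≤ B ∧
          |(torusDeriv (intermittentMap h)^[n] ξ v).2| ≤ B) ↔
        ∃ B, ∀ n, |(torusDeriv (intermittentMap h)^[n] ξ v).1| ≤ B ∧
          |-(torusDeriv (intermittentMap h)^[n] ξ v).2 -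
            a n * (torusDeriv (intermittentMap h)^[n] ξ v).1| ≤ B := by
      constructor
      · rintro ⟨B, hB⟩
        refine ⟨B + C * B, fun n => ?_⟩
        obtain ⟨h1, h2⟩ := hB n
        have h3 := hmul n _ B h1
        have h4 := abs_sub (-(torusDeriv (intermittentMap h)^[n] ξ v).2)
          (a n * (torusDeriv (intermittentMap h)^[n] ξ v).1)
        rw [abs_neg] at h4
        exact ⟨by linarith [abs_nonneg (a n * (torusDeriv (intermittentMap h)^[n] ξ v).1)],
          by linarith⟩
      · rintro ⟨B, hB⟩
        refine ⟨B + C * B, fun n => ?_⟩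
        obtain ⟨h1, h2⟩ := hB n
        have h3 := hmul n _ B h1
        have h4 := abs_add_le (-(torusDeriv (intermittentMap h)^[n] ξ v).2 -
          a n * (torusDeriv (intermittentMap h)^[n] ξ v).1)
          (a n * (torusDeriv (intermittentMap h)^[n] ξ v).1)
        rw [sub_add_cancel, abs_neg] at h4
        exact ⟨by linarith [abs_nonneg (a n * (torusDeriv (intermittentMap h)^[n] ξ v).1)],
          by linarith⟩
    rw [hshear, hiff]
    change -v.2 - a 0 * v.1 = u 0 * v.1 ↔ _
    rw [ha0]
    constructor <;> intro e <;> linarith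
  refine ⟨Submodule.ext fun v => (hmem v).trans (mem_span_slope_iff _ _).symm,
    fun hξ v hv => ?_⟩
  have hpos : 0 < quadSize (reversor h ξ) := by
    have h1 := hh.quadSize_reversor_le (reversor h ξ)
    rw [reversor_reversor] at h1
    refine (quadSize_nonneg _).lt_of_ne fun e => ?_
    rw [← e, mul_zero] at h1
    exact absurd (quadSize_pos hξ) h1.not_gt
  obtain ⟨hp, hr⟩ := (isBackwardTransport_reversor H_smooth H_lift v).tendsto_zero ha hu.nonneg
    hu.invariant
    (by
      simp only [torusDeriv_iterate_zero]
      change -v.2 - a 0 * v.1 = u 0 * v.1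
      rw [ha0]
      linarith [(hmem v).1 hv])
    hk hh.stepConst_nonneg
    (fun n => quadSize_nonneg ((intermittentMap h).symm^[n] (reversor h ξ))) hpos
    (fun n => by
      simpa only [map_symm_iterate_succ] using
        hh.quadSize_map_le ((intermittentMap h).symm^[n + 1] (reversor h ξ)))
    hu.lower
  have hap : Tendsto (fun n => a n * (torusDeriv (intermittentMap h)^[n] ξ v).1) atTop (𝓝 0) :=
    squeeze_zero_norm (fun n => hmul n _ _ le_rfl) (by simpa using hp.abs.const_mul C)
  refine hp.prodMk_nhds ?_
  have := (hr.add hap).neg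
  simp only [add_zero, neg_zero] at this
  have e : ∀ n, -(-(torusDeriv (intermittentMap h)^[n] ξ v).2 -
      circleDeriv H ((intermittentMap h).symm^[n] (reversor h ξ)).1 *
        (torusDeriv (intermittentMap h)^[n] ξ v).1 +
      a n * (torusDeriv (intermittentMap h)^[n] ξ v).1) =
      (torusDeriv (intermittentMap h)^[n] ξ v).2 := fun n => by simp only [hadef]; ring
  exact this.congr e

end

theorem mainTheorem4
    -- `h` is a smooth circle map with smooth lift `H`; the derivatives of `h` are those of `H`
    (h : UnitAddCircle → UnitAddCircle) (H : ℝ → ℝ) (H_smooth : ContDiff ℝ ∞ H)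
    (H_lift : ∀ t : ℝ, h (t : UnitAddCircle) = (H t : UnitAddCircle))
    (h_zero : h 0 = 0)
    (h_neutral : deriv H 0 = 0)
    (h_hyperbolic : ∀ t : ℝ, (t : UnitAddCircle) ≠ 0 → 0 < deriv H t)
    (h_generic : 0 < iteratedDeriv 3 H 0)
    (h_odd : ∀ θ : UnitAddCircle, h (-θ) = -h θ) :
    ∃ Km Kp : ℝ, 0 < Km ∧ 0 < Kp ∧ ∀ ξ : Torus,
      -- the unstable space is a line, spanned by a vector of the cone
      (∃ e ∈ unstableCone Km Kp ξ,
        unstableSpace (intermittentMap h) ξ = Submodule.span ℝ {e}) ∧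
      -- the stable space is a line, spanned by a vector of the reflected cone
      (∃ e ∈ stableCone Km Kp ξ,
        stableSpace (intermittentMap h) ξ = Submodule.span ℝ {e}) ∧
      -- away from the neutral fixed point, the vectors of these two spaces are contracted
      -- in the past and in the future, respectively
      (ξ ≠ 0 →
        (∀ v ∈ unstableSpace (intermittentMap h) ξ,
          Tendsto (fun n : ℕ => torusDeriv ((intermittentMap h).symm)^[n] ξ v) atTop (𝓝 0)) ∧
        (∀ v ∈ stableSpace (intermittentMap h) ξ,
          Tendsto (fun n : ℕ => torusDeriv (intermittentMap h)^[n] ξ v) atTop (𝓝 0))) := by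
  obtain ⟨c, C, hh⟩ := exists_cubicTangency H_smooth H_lift h_zero h_neutral h_hyperbolic h_generic
  obtain ⟨k, K, hk, hK, hslopes⟩ := hh.exists_unstable_slopes
  have hC := hh.C_nonneg
  have hseq : ∀ ξ : Torus, ∃ u,
      IsSlopeSequence H k K (fun n => (intermittentMap h).symm^[n] ξ) u := by
    intro ξ
    obtain ⟨u, hu⟩ := hslopes (fun n => (intermittentMap h).symm^[n] ξ) (map_symm_iterate_succ h ξ)
    exact ⟨u, fun n => (hu n).1, fun n => (hu n).2.1, fun n => (hu n).2.2.1,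
      fun n => (hu n).2.2.2⟩
  refine ⟨k / (2 * (1 + C)), C + K * (1 + C), by positivity, by positivity, fun ξ => ?_⟩
  obtain ⟨u, hu⟩ := hseq ξ
  obtain ⟨w, hw⟩ := hseq (reversor h ξ)
  obtain ⟨hU, hUt⟩ := unstableSpace_of_slopes hh H_smooth H_lift hk hu
  obtain ⟨hS, hSt⟩ := stableSpace_of_slopes hh H_smooth H_lift hk hw
  have hq0 := quadSize_nonneg ξ
  have hq1 := quadSize_le_one ξ
  have hqp := quadSize_le_parabolicSize ξ
  have hpq := parabolicSize_le_quadSize ξ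
  have hlow : ∀ q s : ℝ, quadSize ξ ≤ (1 + C) * q → k * q ≤ s →
      k / (2 * (1 + C)) * parabolicSize ξ ≤ s := by
    intro q s h1 h2
    rw [div_mul_eq_mul_div, div_le_iff₀ (by positivity)]
    have h3 : k * parabolicSize ξ ≤ k * (2 * ((1 + C) * q)) := by gcongr; linarith
    have h4 : 2 * (1 + C) * (k * q) ≤ 2 * (1 + C) * s := by gcongr
    linarith
  have hup : (C + K * (1 + C)) * quadSize ξ ≤ (C + K * (1 + C)) * parabolicSize ξ := by gcongr
  have hCK : 0 ≤ C * quadSize ξ + K * C * quadSize ξ := by positivity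
  refine ⟨⟨_, ⟨u 0, rfl, ?_, ?_⟩, hU⟩, ⟨_, ⟨_, rfl, ?_, ?_⟩, hS⟩, fun hξ => ⟨hUt hξ, hSt hξ⟩⟩
  · exact hlow (quadSize ξ) _ (by linarith [mul_nonneg hC hq0]) (hu.lower 0)
  · have : u 0 ≤ K * quadSize ξ := hu.upper 0
    linarith
  · refine hlow (quadSize (reversor h ξ)) _ ?_ ?_
    · simpa only [reversor_reversor] using hh.quadSize_reversor_le (reversor h ξ)
    · have : k * quadSize (reversor h ξ) ≤ w 0 := hw.lower 0
      linarith [hh.circleDeriv_nonneg ξ.1]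
  · have h1 : w 0 ≤ K * quadSize (reversor h ξ) := hw.upper 0
    have h2 : K * quadSize (reversor h ξ) ≤ K * ((1 + C) * quadSize ξ) := by
      gcongr; exact hh.quadSize_reversor_le ξ
    have h3 : circleDeriv H ξ.1 ≤ C * quadSize ξ := by
      refine (hh.circleDeriv_le_quadSize_sq ξ).trans ?_
      gcongr
      exact pow_le_of_le_one hq0 hq1 (by norm_num)
    linarith
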